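/- Let $q,r\ge 2$ be integers. For $s\ge2$ let $\mathbb T_s$ be the homogeneous tree of degree $s+1$, with a root $o$, graph distance $d$ and a fixed end $\omega$. For vertices $x,y$ of $\mathbb T_s$ let $x\curlywedge y$ be the first common vertex of the geodesic rays from $x$ and from $y$ to $\omega$, and put $$\mathfrak u(x)=d(o,x\curlywedge o),\qquad \mathfrak d(x)=d(x,x\curlywedge o),\qquad \mathfrak h(x)=\mathfrak d(x)-\mathfrak u(x).$$ The Diestel–Leader graph $DL(q,r)$ has vertex set $\{x_1x_2\in\mathbb T_q\times\mathbb T_r:\mathfrak h(x_1)+\mathfrak h(x_2)=0\}$, and $x_1x_2\sim y_1y_2$ if and only if $x_1\sim y_1$ and $x_2\sim y_2$; its reference vertex is $o=o_1o_2$, where $o_1,o_2$ are the roots of $\mathbb T_q,\mathbb T_r$. It is regular of degree $q+r$. Let $P$ be the transition operator of simple random walk, $Pf(x)=\frac1{q+r}\sum_{y\sim x}f(y)$, on $\ell^2(DL(q,r))$, let $E$ be its resolution of the identity, i.e. the projection-valued Borel measure that lives on $\operatorname{spec}(P)$ and satisfies $P^N=\int\lambda^N\,E(d\lambda)$ for all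 $N\ge0$, and for $x\in DL(q,r)$ put $\mu_{o,x}(B)=\langle\delta_o,E(B)\delta_x\rangle$ for Borel sets $B$. For integers $1\le m<n$ put $\lambda_{m,n}=\frac{2\sqrt{qr}}{q+r}\cos\frac{m}{n}\pi$. For integers $k_1,k_2\ge0$ let $$C_{k_1,k_2}=\begin{cases}(q-1)(r-1)&\text{if }k_1>0,\ k_2>0,\\-(r-1)&\text{if }k_1=0,\ k_2>0,\\-(q-1)&\text{if }k_1>0,\ k_2=0,\\1&\text{if }k_1=k_2=0.\end{cases}$$ **Proposition.** Let $x=x_1x_2\in DL(q,r)$, and write $\mathfrak u_i=\mathfrak u(x_i)$, $\mathfrak d_i=\mathfrak d(x_i)$ and $\nu=\mathfrak u_1+\mathfrak u_2$. The resolution of the identity $E$ exists, and $\mu_{o,x}$ is atomic: for every Borel set $B\subseteq\mathbb R$, $$\mu_{o,x}(B)=\sum_{\substack{1\le m<n,\ \gcd(m,n)=1\\ \lambda_{m,n}\in B}}\mu_{o,x}(\{\lambda_{m,n}\})$$ with absolute convergence. If $1\le m<n$ and $m$ and $n$ are relatively prime, then $$\mu_{o,x}(\{\lambda_{m,n}\})=\sum_{\ell=\max\{1,\lceil\nu/n\rceil\}}^{\infty}\frac{2r^{-\ell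 n}}{\ell n}\sum_{k=0}^{\ell n-\nu}C_{k,\,\ell n-\nu-k}\,(r/q)^{k+d(x_1,o_1)/2}\,\sin\Bigl((k+\mathfrak u_1)\tfrac mn\pi\Bigr)\sin\Bigl((k+\mathfrak d_1)\tfrac mn\pi\Bigr),$$ where the series over $\ell$ converges absolutely. -/

import Mathlib

namespace DiestelLeader

open MeasureTheory Set
open scoped InnerProductSpace ENNReal

/-! ### The homogeneous tree with its reference end, in horocyclic coordinates -/

/-- Vertices of the homogeneous tree `𝕋_q` of degree `q + 1`, with a reference end `ω`.  A vertex on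
the horocycle `H_k` is recorded by `k` and by the labels (in `ℤ/q`, finitely many of them nonzero)
of the edges of its geodesic ray to `ω`: `label i` is the label of the edge of that ray that joins
`H_{i-1}` to `H_i`, for `i ≤ k`.  (This is `Σ_q × ℤ`, with the sequences indexed by `i ≤ k` in
place of `i ≤ 0`.) -/
@[ext]
structure Tree (q : ℕ) where
  level : ℤ
  label : ℤ →₀ ZMod q
  label_eq_zero : ∀ i, level < i → label i = 0

namespace Tree

variable {q : ℕ}

/-- The predecessor `x⁻` of `x`: the neighbour of `x` in the direction of the end `ω`. -/
noncomputable def pred (x : Tree q) : Tree q where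
  level := x.level - 1
  label := x.label.erase x.level
  label_eq_zero i hi := by
    rcases eq_or_ne i x.level with rfl | h
    · simp
    · rw [Finsupp.erase_ne h]
      exact x.label_eq_zero i (by omega)

/-- The successor of `x` along the downward edge with label `s`. -/
noncomputable def succ (x : Tree q) (s : ZMod q) : Tree q where
  level := x.level + 1
  label := x.label.update (x.level + 1) s
  label_eq_zero i hi := by
    rw [Finsupp.coe_update, Function.update_of_ne (by omega)]
    exact x.label_eq_zero i (by omega)

/-- The root `o`: the vertex of `H_0` whose ray to `ω` has all labels `0`. -/
def root (q : ℕ) : Tree q where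
  level := 0
  label := 0
  label_eq_zero _ _ := rfl

@[simp] theorem level_pred (x : Tree q) : x.pred.level = x.level - 1 := rfl

@[simp] theorem level_succ (x : Tree q) (s : ZMod q) : (x.succ s).level = x.level + 1 := rfl

@[simp] theorem level_root : (root q).level = 0 := rfl

@[simp] theorem pred_succ (x : Tree q) (s : ZMod q) : (x.succ s).pred = x := by
  ext i
  · simp
  · change ((x.label.update (x.level + 1) s).erase (x.level + 1)) i = x.label i
    rcases eq_or_ne i (x.level + 1) with rfl | h
    · rw [Finsupp.erase_same, x.label_eq_zero _ (by omega)]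
    · rw [Finsupp.erase_ne h, Finsupp.coe_update, Function.update_of_ne h]

theorem succ_pred (x : Tree q) : x.pred.succ (x.label x.level) = x := by
  ext i
  · simp
  · change ((x.label.erase x.level).update (x.level - 1 + 1) (x.label x.level)) i = x.label i
    rw [sub_add_cancel, Finsupp.coe_update]
    rcases eq_or_ne i x.level with rfl | h
    · simp
    · rw [Function.update_of_ne h, Finsupp.erase_ne h]

theorem succ_injective (x : Tree q) : Function.Injective x.succ := by
  intro s t h
  have := congrArg (fun y : Tree q => y.label (x.level + 1)) h
  simpa [succ, Finsupp.coe_update] using this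

/-- The tree `𝕋_q` as a graph: every vertex is joined to its predecessor. -/
def graph (q : ℕ) : SimpleGraph (Tree q) where
  Adj x y := y = x.pred ∨ x = y.pred
  symm := ⟨fun _ _ h => h.symm⟩
  loopless := ⟨fun x h => by
    have h' : x = x.pred := by tauto
    have h2 : x.level = x.level - 1 := congrArg Tree.level h'
    omega⟩

theorem adj_pred (x : Tree q) : (graph q).Adj x x.pred := Or.inl rfl

theorem level_iterate_pred (x : Tree q) (n : ℕ) : (pred^[n] x).level = x.level - n := by
  induction n with
  | zero => simp
  | succ n ih => rw [Function.iterate_succ_apply', level_pred, ih]; push_cast; ring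

theorem label_iterate_pred (x : Tree q) (n : ℕ) (i : ℤ) :
    (pred^[n] x).label i = if i ≤ x.level - n then x.label i else 0 := by
  induction n with
  | zero =>
    split_ifs with h
    · rfl
    · exact x.label_eq_zero i (by simpa using h)
  | succ n ih =>
    rw [Function.iterate_succ_apply']
    change ((pred^[n] x).label.erase (pred^[n] x).level) i = _
    rw [level_iterate_pred]
    rcases eq_or_ne i (x.level - n) with h | h
    · rw [h, Finsupp.erase_same, if_neg (by push_cast; omega)]
    · rw [Finsupp.erase_ne h, ih]
      push_cast
      split_ifs <;> first | rfl | omega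

/-- Any two rays towards `ω` meet. -/
theorem exists_iterate_pred_eq (x y : Tree q) : ∃ n m : ℕ, pred^[n] x = pred^[m] y := by
  classical
  obtain ⟨b, hb⟩ : ∃ b : ℤ, ∀ i, i ≤ b → x.label i = y.label i ∧ i ≤ x.level ∧ i ≤ y.level := by
    have h1 : ((x.label.support ∪ y.label.support ∪ {x.level, y.level} : Finset ℤ) : Set ℤ).Finite :=
      Finset.finite_toSet _
    obtain ⟨b, hb⟩ := h1.bddBelow
    refine ⟨b - 1, fun i hi => ⟨?_, ?_, ?_⟩⟩
    · have hx : i ∉ x.label.support := fun h => by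
        have := hb (show i ∈ _ by simp only [Finset.coe_union]; left; left; exact h)
        omega
      have hy : i ∉ y.label.support := fun h => by
        have := hb (show i ∈ _ by simp only [Finset.coe_union]; left; right; exact h)
        omega
      rw [Finsupp.notMem_support_iff.mp hx, Finsupp.notMem_support_iff.mp hy]
    · have := hb (show x.level ∈ _ by simp)
      omega
    · have := hb (show y.level ∈ _ by simp)
      omega
  have hbb := hb b le_rfl
  refine ⟨(x.level - b).toNat, (y.level - b).toNat, ?_⟩
  have e1 : x.level - ((x.level - b).toNat : ℤ) = b := by omega
  have e2 : y.level - ((y.level - b).toNat : ℤ) = b := by omega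
  ext i
  · rw [level_iterate_pred, level_iterate_pred, e1, e2]
  · rw [label_iterate_pred, label_iterate_pred, e1, e2]
    split_ifs with h
    · exact (hb i h).1
    · rfl

/-- The confluent `x ⋏ y` with respect to `ω`: the geodesic rays from `x` and from `y` to `ω` are
`x, x⁻, x⁻⁻, …` and `y, y⁻, y⁻⁻, …`; the confluent is the first vertex of the former that lies on
the latter. -/
noncomputable def confluent (x y : Tree q) : Tree q :=
  pred^[sInf {n : ℕ | ∃ m : ℕ, pred^[n] x = pred^[m] y}] x

/-- `up x = d(o, x ⋏ o)`. -/
noncomputable def up (x : Tree q) : ℕ := (graph q).dist (root q) (confluent x (root q))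

/-- `dn x = d(x, x ⋏ o)`. -/
noncomputable def dn (x : Tree q) : ℕ := (graph q).dist x (confluent x (root q))

/-- The Busemann function with respect to `ω`. -/
noncomputable def hor (x : Tree q) : ℤ := (dn x : ℤ) - (up x : ℤ)

theorem exists_walk_iterate_pred (x : Tree q) (n : ℕ) :
    ∃ w : (graph q).Walk x (pred^[n] x), w.length = n := by
  induction n with
  | zero => exact ⟨SimpleGraph.Walk.nil, rfl⟩
  | succ n ih =>
    obtain ⟨w, hw⟩ := ih
    rw [Function.iterate_succ_apply']
    exact ⟨w.concat (adj_pred _), by rw [SimpleGraph.Walk.length_concat, hw]⟩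

theorem level_le_of_walk {x y : Tree q} (w : (graph q).Walk x y) :
    x.level - y.level ≤ w.length := by
  induction w with
  | nil => simp
  | cons h w ih =>
    rw [SimpleGraph.Walk.length_cons]
    rcases h with h | h <;> have := congrArg level h <;> simp at this <;> push_cast <;> omega

theorem dist_iterate_pred (x : Tree q) (n : ℕ) : (graph q).dist x (pred^[n] x) = n := by
  obtain ⟨w, hw⟩ := exists_walk_iterate_pred x n
  refine le_antisymm ((SimpleGraph.dist_le w).trans_eq hw) ?_
  obtain ⟨w', hw'⟩ := w.reachable.exists_walk_length_eq_dist
  have := level_le_of_walk w'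
  rw [level_iterate_pred, hw'] at this
  omega

/-- The horocycle `H_k` consists of the vertices with `level = k`. -/
theorem hor_eq_level (x : Tree q) : hor x = x.level := by
  have hne : {n : ℕ | ∃ m : ℕ, pred^[n] x = pred^[m] (root q)}.Nonempty :=
    exists_iterate_pred_eq x (root q)
  obtain ⟨m, hm⟩ := Nat.sInf_mem hne
  set n := sInf {n : ℕ | ∃ m : ℕ, pred^[n] x = pred^[m] (root q)} with hn
  have hc : confluent x (root q) = pred^[n] x := rfl
  have h1 : dn x = n := by rw [dn, hc, dist_iterate_pred]
  have h2 : up x = m := by rw [up, hc, hm, dist_iterate_pred]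
  have h3 := congrArg level hm
  rw [level_iterate_pred, level_iterate_pred, level_root] at h3
  rw [hor, h1, h2]
  omega

end Tree

/-! ### The Diestel-Leader graph -/

/-- The vertex set of `DL(q,r)`. -/
def Vertex (q r : ℕ) : Type := {p : Tree q × Tree r // p.1.hor + p.2.hor = 0}

variable {q r : ℕ}

/-- The component of a vertex of `DL(q,r)` in the first tree. -/
def Vertex.fst (x : Vertex q r) : Tree q := x.1.1

/-- The component of a vertex of `DL(q,r)` in the second tree. -/
def Vertex.snd (x : Vertex q r) : Tree r := x.1.2

theorem Vertex.ext' {x y : Vertex q r} (h1 : x.fst = y.fst) (h2 : x.snd = y.snd) : x = y :=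
  Subtype.ext (Prod.ext h1 h2)

theorem Vertex.level_add (x : Vertex q r) : x.fst.level + x.snd.level = 0 := by
  have := x.2
  rwa [Tree.hor_eq_level, Tree.hor_eq_level] at this

/-- The Diestel-Leader graph `DL(q,r)`. -/
def graph (q r : ℕ) : SimpleGraph (Vertex q r) where
  Adj x y := (Tree.graph q).Adj x.fst y.fst ∧ (Tree.graph r).Adj x.snd y.snd
  symm := ⟨fun _ _ h => ⟨h.1.symm, h.2.symm⟩⟩
  loopless := ⟨fun _ h => (Tree.graph q).irrefl h.1⟩

/-- The reference vertex `o = o₁o₂`. -/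
def origin (q r : ℕ) : Vertex q r :=
  ⟨(Tree.root q, Tree.root r), by rw [Tree.hor_eq_level, Tree.hor_eq_level]; rfl⟩

/-- The neighbours of `x`: either the first component goes to a successor and the second one to its
predecessor, or the other way round. -/
noncomputable def step (x : Vertex q r) : ZMod q ⊕ ZMod r → Vertex q r
  | Sum.inl s => ⟨(x.fst.succ s, x.snd.pred), by
      have := x.level_add
      rw [Tree.hor_eq_level, Tree.hor_eq_level, Tree.level_succ, Tree.level_pred]; omega⟩
  | Sum.inr t => ⟨(x.fst.pred, x.snd.succ t), by
      have := x.level_add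
      rw [Tree.hor_eq_level, Tree.hor_eq_level, Tree.level_succ, Tree.level_pred]; omega⟩

theorem step_injective (x : Vertex q r) : Function.Injective (step x) := by
  rintro (s | s) (t | t) h
  · exact congrArg Sum.inl (x.fst.succ_injective (congrArg Vertex.fst h))
  · have := congrArg (fun y : Vertex q r => y.fst.level) h
    simp [step, Vertex.fst] at this
    omega
  · have := congrArg (fun y : Vertex q r => y.fst.level) h
    simp [step, Vertex.fst] at this
    omega
  · exact congrArg Sum.inr (x.snd.succ_injective (congrArg Vertex.snd h))

theorem range_step (x : Vertex q r) : Set.range (step x) = (graph q r).neighborSet x := by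
  ext y
  rw [SimpleGraph.mem_neighborSet]
  constructor
  · rintro ⟨s | t, rfl⟩
    · exact ⟨Or.inr (Tree.pred_succ _ s).symm, Or.inl rfl⟩
    · exact ⟨Or.inl rfl, Or.inr (Tree.pred_succ _ t).symm⟩
  · have hx := x.level_add
    have hy := y.level_add
    rintro ⟨h1 | h1, h2 | h2⟩
    · have e1 := congrArg Tree.level h1
      have e2 := congrArg Tree.level h2
      simp at e1 e2
      omega
    · refine ⟨Sum.inr (y.snd.label y.snd.level), Vertex.ext' h1.symm ?_⟩
      change x.snd.succ _ = y.snd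
      rw [h2, Tree.succ_pred]
    · refine ⟨Sum.inl (y.fst.label y.fst.level), Vertex.ext' ?_ h2.symm⟩
      change x.fst.succ _ = y.fst
      rw [h1, Tree.succ_pred]
    · have e1 := congrArg Tree.level h1
      have e2 := congrArg Tree.level h2
      simp at e1 e2
      omega

/-- The neighbours of `x` are in bijection with `ℤ/q ⊔ ℤ/r`. -/
noncomputable def neighborEquiv (x : Vertex q r) :
    ZMod q ⊕ ZMod r ≃ (graph q r).neighborSet x :=
  (Equiv.ofInjective _ (step_injective x)).trans (Equiv.setCongr (range_step x))

noncomputable instance instLocallyFinite [NeZero q] [NeZero r] : (graph q r).LocallyFinite :=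
  fun x => Fintype.ofEquiv _ (neighborEquiv x)

theorem isRegular [NeZero q] [NeZero r] : (graph q r).IsRegularOfDegree (q + r) := by
  intro x
  rw [← SimpleGraph.card_neighborSet_eq_degree, ← Fintype.card_congr (neighborEquiv x),
    Fintype.card_sum, ZMod.card, ZMod.card]

/-! ### The transition operator of simple random walk -/

section Walk

variable {V : Type*} (G : SimpleGraph V) [G.LocallyFinite]

/-- `Pf(x) = ∑_y p(x,y) f(y)` with `p(x,y) = 1/deg(x)` if `y ∼ x`, and `p(x,y) = 0` otherwise. -/
noncomputable def srwFun (f : V → ℂ) (x : V) : ℂ :=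
  ∑ y ∈ G.neighborFinset x, (1 / (G.degree x : ℂ)) * f y

variable {G} {d : ℕ}

theorem sum_norm_srwFun_le (hG : G.IsRegularOfDegree d) (f : lp (fun _ : V => ℂ) 2)
    (s : Finset V) : ∑ x ∈ s, ‖srwFun G f x‖ ^ (2 : ℝ≥0∞).toReal ≤ ‖f‖ ^ (2 : ℝ≥0∞).toReal := by
  classical
  have h2 : (2 : ℝ≥0∞).toReal = ((2 : ℕ) : ℝ) := by norm_num
  rcases Nat.eq_zero_or_pos d with hd | hd
  · have : ∀ x, srwFun G f x = 0 := fun x => by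
      have hx : (G.neighborFinset x).card = 0 := by
        rw [SimpleGraph.card_neighborFinset_eq_degree, hG.degree_eq, hd]
      rw [srwFun, Finset.card_eq_zero.mp hx, Finset.sum_empty]
    simp only [this]
    rw [Finset.sum_eq_zero (fun x _ => by simp)]
    positivity
  have hd' : (0 : ℝ) < d := by exact_mod_cast hd
  have key : ∀ x, ‖srwFun G f x‖ ^ 2 ≤ (1 / (d : ℝ)) * ∑ y ∈ G.neighborFinset x, ‖f y‖ ^ 2 := by
    intro x
    have e1 : ‖srwFun G f x‖ ≤ (1 / (d : ℝ)) * ∑ y ∈ G.neighborFinset x, ‖f y‖ := by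
      rw [srwFun, ← Finset.mul_sum, norm_mul, hG.degree_eq]
      have : ‖(1 / (d : ℂ))‖ = 1 / (d : ℝ) := by simp
      rw [this]
      exact mul_le_mul_of_nonneg_left (norm_sum_le _ _) (by positivity)
    have e2 := sq_sum_le_card_mul_sum_sq (s := G.neighborFinset x) (f := fun y => ‖f y‖)
    rw [SimpleGraph.card_neighborFinset_eq_degree, hG.degree_eq] at e2
    calc ‖srwFun G f x‖ ^ 2 ≤ ((1 / (d : ℝ)) * ∑ y ∈ G.neighborFinset x, ‖f y‖) ^ 2 := by gcongr
      _ = (1 / (d : ℝ)) ^ 2 * (∑ y ∈ G.neighborFinset x, ‖f y‖) ^ 2 := by ring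
      _ ≤ (1 / (d : ℝ)) ^ 2 * (d * ∑ y ∈ G.neighborFinset x, ‖f y‖ ^ 2) := by gcongr
      _ = _ := by field_simp
  have hsum : Summable fun y => ‖f y‖ ^ 2 := by
    have := (lp.memℓp f).summable (by norm_num)
    simpa [h2, Real.rpow_natCast] using this
  have hnorm : ‖f‖ ^ 2 = ∑' y, ‖f y‖ ^ 2 := by
    have := lp.norm_rpow_eq_tsum (p := 2) (by norm_num) f
    simpa [h2, Real.rpow_natCast] using this
  simp only [h2, Real.rpow_natCast]
  calc ∑ x ∈ s, ‖srwFun G f x‖ ^ 2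
      ≤ ∑ x ∈ s, (1 / (d : ℝ)) * ∑ y ∈ G.neighborFinset x, ‖f y‖ ^ 2 :=
        Finset.sum_le_sum fun x _ => key x
    _ = (1 / (d : ℝ)) * ∑ x ∈ s, ∑ y ∈ G.neighborFinset x, ‖f y‖ ^ 2 := by rw [Finset.mul_sum]
    _ = (1 / (d : ℝ)) * ∑ y ∈ s.biUnion (fun x => G.neighborFinset x),
          ∑ x ∈ s.filter (fun x => G.Adj x y), ‖f y‖ ^ 2 := by
        congr 1
        refine Finset.sum_comm' fun x y => ?_
        simp only [Finset.mem_filter, Finset.mem_biUnion, SimpleGraph.mem_neighborFinset]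
        constructor
        · rintro ⟨h1, h2⟩; exact ⟨⟨h1, h2⟩, x, h1, h2⟩
        · rintro ⟨h, _⟩; exact h
    _ ≤ (1 / (d : ℝ)) * ∑ y ∈ s.biUnion (fun x => G.neighborFinset x), (d : ℝ) * ‖f y‖ ^ 2 := by
        gcongr with y
        rw [Finset.sum_const, nsmul_eq_mul]
        gcongr
        rw [← hG.degree_eq y, ← SimpleGraph.card_neighborFinset_eq_degree]
        refine Finset.card_le_card fun x hx => ?_
        rw [SimpleGraph.mem_neighborFinset]
        exact (Finset.mem_filter.mp hx).2.symm
    _ = ∑ y ∈ s.biUnion (fun x => G.neighborFinset x), ‖f y‖ ^ 2 := by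
        rw [← Finset.mul_sum, ← mul_assoc]; field_simp
    _ ≤ ∑' y, ‖f y‖ ^ 2 := hsum.sum_le_tsum _ fun _ _ => by positivity
    _ = ‖f‖ ^ 2 := hnorm.symm

/-- The transition operator `P` of simple random walk on a regular graph, as a bounded operator on
the Hilbert space `ℓ²(V)`. -/
noncomputable def srw (hG : G.IsRegularOfDegree d) :
    lp (fun _ : V => ℂ) 2 →L[ℂ] lp (fun _ : V => ℂ) 2 :=
  LinearMap.mkContinuous
    { toFun := fun f => ⟨srwFun G f, memℓp_gen' (sum_norm_srwFun_le hG f)⟩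
      map_add' := fun f g => by
        ext x
        change srwFun G (f + g) x = srwFun G f x + srwFun G g x
        simp [srwFun, mul_add, Finset.sum_add_distrib]
      map_smul' := fun c f => by
        ext x
        change srwFun G (c • f) x = c * srwFun G f x
        simp [srwFun, Finset.mul_sum, mul_left_comm] }
    1 fun f => by
      rw [one_mul]
      exact lp.norm_le_of_forall_sum_le (by norm_num) (norm_nonneg _) (sum_norm_srwFun_le hG f)

theorem srw_apply (hG : G.IsRegularOfDegree d) (f : lp (fun _ : V => ℂ) 2) (x : V) :
    srw hG f x = ∑ y ∈ G.neighborFinset x, (1 / (G.degree x : ℂ)) * f y := rfl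

end Walk

/-! ### Resolutions of the identity and spectral measures -/

section Spectral

variable (H : Type*) [NormedAddCommGroup H] [InnerProductSpace ℂ H] [CompleteSpace H]

/-- A projection-valued measure on the Borel sets of `ℝ` (the values on other sets are
irrelevant). -/
structure ProjectionValuedMeasure where
  toFun : Set ℝ → H →L[ℂ] H
  isStarProjection : ∀ B, MeasurableSet B → IsStarProjection (toFun B)
  univ : toFun Set.univ = 1
  inter : ∀ B C, MeasurableSet B → MeasurableSet C → toFun (B ∩ C) = toFun B * toFun C
  iUnion : ∀ f : ℕ → Set ℝ, (∀ i, MeasurableSet (f i)) → Pairwise (Function.onFun Disjoint f) →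
    ∀ v, HasSum (fun i => toFun (f i) v) (toFun (⋃ i, f i) v)

variable {H}

namespace ProjectionValuedMeasure

variable (E : ProjectionValuedMeasure H)

theorem empty_apply (v : H) : E.toFun ∅ v = 0 := by
  have h := (E.iUnion (fun _ => ∅) (fun _ => MeasurableSet.empty)
    (fun _ _ _ => disjoint_bot_left) v).summable
  exact (summable_const_iff (β := ℕ) (E.toFun ∅ v)).mp h

/-- The complex measure `B ↦ ⟨u, E(B) v⟩`. -/
noncomputable def matrixElement (u v : H) : VectorMeasure ℝ ℂ := by
  classical
  exact
  { measureOf' := fun B => if MeasurableSet B then ⟪u, E.toFun B v⟫_ℂ else 0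
    empty' := by simp [empty_apply]
    not_measurable' := fun B hB => if_neg hB
    m_iUnion' := fun f hf hd => by
      simp only [hf, MeasurableSet.iUnion hf, if_true]
      exact (E.iUnion f hf hd v).mapL (innerSL ℂ u) }

theorem matrixElement_apply (u v : H) {B : Set ℝ} (hB : MeasurableSet B) :
    E.matrixElement u v B = ⟪u, E.toFun B v⟫_ℂ := if_pos hB

theorem re_inner_nonneg (v : H) {B : Set ℝ} (hB : MeasurableSet B) :
    0 ≤ (⟪v, E.toFun B v⟫_ℂ).re :=
  (ContinuousLinearMap.IsPositive.of_isStarProjection (E.isStarProjection B hB)).re_inner_nonneg_right v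

/-- The positive finite measure `B ↦ ⟨v, E(B) v⟩`. -/
noncomputable def diagonal (v : H) : Measure ℝ :=
  Measure.ofMeasurable (fun B _ => ENNReal.ofReal (⟪v, E.toFun B v⟫_ℂ).re)
    (by simp [empty_apply])
    (fun f hf hd => by
      have h := Complex.hasSum_re ((E.iUnion f hf hd v).mapL (innerSL ℂ v))
      have h' : HasSum (fun i => (⟪v, E.toFun (f i) v⟫_ℂ).re)
        (⟪v, E.toFun (⋃ i, f i) v⟫_ℂ).re := h
      rw [← h'.tsum_eq]
      exact ENNReal.ofReal_tsum_of_nonneg (fun i => E.re_inner_nonneg v (hf i)) h'.summable)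

theorem diagonal_apply (v : H) {B : Set ℝ} (hB : MeasurableSet B) :
    E.diagonal v B = ENNReal.ofReal (⟪v, E.toFun B v⟫_ℂ).re :=
  Measure.ofMeasurable_apply B hB

end ProjectionValuedMeasure

/-- `E` is the resolution of the identity of the operator `A`: it lives on the spectrum of `A`, and
`A ^ N = ∫ λ ^ N E(dλ)` for all `N ≥ 0`, in the weak sense.  (By polarization it is enough to
say this for the quadratic forms.) -/
def IsResolutionOfIdentity (A : H →L[ℂ] H) (E : ProjectionValuedMeasure H) : Prop :=
  E.toFun (spectrum ℝ A)ᶜ = 0 ∧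
  ∀ (N : ℕ) (v : H), ⟪v, (A ^ N) v⟫_ℂ = ((∫ t, t ^ N ∂(E.diagonal v) : ℝ) : ℂ)

end Spectral

/-! ### The objects of the formula -/

/-- The transition operator of simple random walk on `DL(q,r)`, on `ℓ²(DL(q,r))`. -/
noncomputable def transitionOperator (q r : ℕ) [NeZero q] [NeZero r] :
    lp (fun _ : Vertex q r => ℂ) 2 →L[ℂ] lp (fun _ : Vertex q r => ℂ) 2 :=
  srw (isRegular (q := q) (r := r))

/-- The point mass `δ_x`, as an element of `ℓ²(DL(q,r))`. -/
noncomputable def pointMass (x : Vertex q r) : lp (fun _ : Vertex q r => ℂ) 2 :=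
  letI := Classical.decEq (Vertex q r)
  lp.single 2 x 1

/-- The eigenvalue `λ_{m,n} = (2 √(qr) / (q+r)) cos (mπ/n)`. -/
noncomputable def eigenvalue (q r m n : ℕ) : ℝ :=
  2 * √((q : ℝ) * r) / ((q : ℝ) + r) * Real.cos (((m : ℝ) / n) * Real.pi)

/-- The constants `C_{k₁,k₂}`. -/
noncomputable def coeff (q r k₁ k₂ : ℕ) : ℝ :=
  if 0 < k₁ then
    if 0 < k₂ then ((q : ℝ) - 1) * ((r : ℝ) - 1) else -((q : ℝ) - 1)
  else
    if 0 < k₂ then -((r : ℝ) - 1) else 1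

/-- The number `ν = up(x₁) + up(x₂)`. -/
noncomputable def nu (x : Vertex q r) : ℕ := x.fst.up + x.snd.up

/-- The `ℓ`-th term of the series for the mass at `λ_{m,n}`. -/
noncomputable def term (x : Vertex q r) (m n l : ℕ) : ℝ :=
  2 * ((r : ℝ) ^ (l * n))⁻¹ / ((l : ℝ) * n) *
    ∑ k ∈ Finset.range (l * n - nu x + 1),
      coeff q r k (l * n - nu x - k) *
        ((r : ℝ) / q) ^
          ((k : ℝ) + ((Tree.graph q).dist x.fst (Tree.root q) : ℝ) / 2) *
        Real.sin (((k : ℝ) + x.fst.up) * ((m : ℝ) / n) * Real.pi) *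
        Real.sin (((k : ℝ) + x.fst.dn) * ((m : ℝ) / n) * Real.pi)

end DiestelLeader

/-! The space `ℓ²(DL(q,r))` is spanned by finitely supported eigenvectors of `P`, each living on a
finite "tetrahedron", and the mass is read off by expanding `δ_x` in them.

In one tree, `branch c i` is constant on each branch below `c⁻` and has mean zero, and a point mass
is the telescoping sum of `q^{-k} branch (pred^[k] x) k` (`Tree.hasSum_branch`). Products `tetra c₁
c₂ a b` of two branch functions therefore expand `δ_x` absolutely in `ℓ²` (`hasSum_tetra`). Summing
over neighbours sends `tetra c₁ c₂ a b` to `q · tetra c₁ c₂ (a-1) (b+1) + r · tetra c₁ c₂ (a+1)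
(b-1)`, where mean zero kills the terms with a negative index. For fixed `a + b = N` this is a
weighted path with `N + 1` vertices. Rescaling by powers of `√(r/q)` makes it symmetric, so sine
profiles give eigenvectors `wave` with eigenvalues `λ_{m,N+2}` (`transitionOperator_wave`), and
discrete Fourier inversion recovers each `tetra` (`tetra_eq_sum_wave`).

Hence the eigenvectors are total and a resolution of the identity exists. Conversely, any resolution
acts on an eigenvector by the indicator of its eigenvalue (`apply_eigenvector`), so `⟨δ_o, E(B)
δ_x⟩` is a sum over `(N, m)` of explicit amplitudes (`hasSum_amplitude`). Evaluation at `o` leaves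
one `tetra` per tetrahedron, which gives the closed form (`amplitude_eq_term`). Absolute summability
allows regrouping the pairs `(N + 2, m)` as multiples `(ℓn, ℓm)` of reduced fractions
(`hasSum_reduced`), and distinct reduced fractions give distinct eigenvalues. -/

namespace DiestelLeader

open MeasureTheory Set
open scoped InnerProductSpace ENNReal
open Finset.HasAntidiagonal (antidiagonal)

/-! ### Tree geometry and branch functions -/

namespace Tree

variable {q : ℕ}

/-- Distance along a ray counts predecessor steps, so `dn` and `up` are exponents of `pred`. All
later bookkeeping uses this form. -/
theorem iterate_pred_dn (x : Tree q) : pred^[dn x] x = pred^[up x] (root q) ∧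
    ∀ n m : ℕ, pred^[n] x = pred^[m] (root q) → dn x ≤ n := by
  have hne : {n : ℕ | ∃ m : ℕ, pred^[n] x = pred^[m] (root q)}.Nonempty :=
    exists_iterate_pred_eq x (root q)
  obtain ⟨m, hm⟩ := Nat.sInf_mem hne
  set n := sInf {n : ℕ | ∃ m : ℕ, pred^[n] x = pred^[m] (root q)} with hn
  have hc : confluent x (root q) = pred^[n] x := rfl
  have h1 : dn x = n := by rw [dn, hc, dist_iterate_pred]
  have h2 : up x = m := by rw [up, hc, hm, dist_iterate_pred]
  rw [h1, h2]
  exact ⟨hm, fun k l h => Nat.sInf_le ⟨l, h⟩⟩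

theorem level_eq (x : Tree q) : x.level = dn x - up x := (hor_eq_level x).symm

/-- From the confluent on the two rays coincide, and comparing levels ties one exponent to the
other. -/
theorem iterate_pred_eq_root_iff (x : Tree q) (n m : ℕ) :
    pred^[n] x = pred^[m] (root q) ↔ dn x ≤ n ∧ m + dn x = n + up x := by
  obtain ⟨h1, h2⟩ := iterate_pred_dn x
  constructor
  · intro h
    refine ⟨h2 n m h, ?_⟩
    have := congrArg level h
    rw [level_iterate_pred, level_iterate_pred, level_root, level_eq] at this
    omega
  · rintro ⟨h, h'⟩
    obtain ⟨k, rfl⟩ := Nat.exists_eq_add_of_le h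
    obtain rfl : m = up x + k := by omega
    rw [add_comm, Function.iterate_add_apply, h1, add_comm (up x), Function.iterate_add_apply]

/-- Prepending an upward edge lengthens the first ascent. Prepending a downward edge cancels a step
of it or, if there is none, lengthens the second. This is the lower bound needed for `dist_root`. -/
theorem exists_iterate_pred_eq_of_walk {x y : Tree q} (w : (graph q).Walk x y) :
    ∃ a b : ℕ, pred^[a] x = pred^[b] y ∧ a + b ≤ w.length := by
  induction w with
  | nil => exact ⟨0, 0, rfl, by simp⟩
  | cons h w ih =>
    obtain ⟨a, b, hab, hl⟩ := ih
    rw [SimpleGraph.Walk.length_cons]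
    rcases h with h | h
    · subst h
      exact ⟨a + 1, b, by rwa [Function.iterate_succ_apply], by omega⟩
    · subst h
      cases a with
      | zero =>
        refine ⟨0, b + 1, ?_, by omega⟩
        rw [Function.iterate_succ_apply', ← hab]
        rfl
      | succ a => exact ⟨a, b, by rwa [Function.iterate_succ_apply] at hab, by omega⟩

theorem dist_root (x : Tree q) : (graph q).dist x (root q) = up x + dn x := by
  have h1 := (iterate_pred_dn x).1
  obtain ⟨w1, hw1⟩ := exists_walk_iterate_pred x (dn x)
  obtain ⟨w2, hw2⟩ := exists_walk_iterate_pred (root q) (up x)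
  let w := w1.append ((w2.copy rfl h1.symm).reverse)
  have hw : w.length = up x + dn x := by
    simp [w, hw1, hw2, add_comm]
  refine le_antisymm ((SimpleGraph.dist_le w).trans_eq hw) ?_
  obtain ⟨w', hw'⟩ := w.reachable.exists_walk_length_eq_dist
  obtain ⟨a, b, hab, hl⟩ := exists_iterate_pred_eq_of_walk w'
  have := (iterate_pred_eq_root_iff x a b).1 hab
  omega

theorem pred_eq_iff (x y : Tree q) : pred y = x ↔ ∃ s, y = succ x s := by
  constructor
  · rintro rfl
    exact ⟨_, (succ_pred y).symm⟩
  · rintro ⟨s, rfl⟩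
    exact pred_succ x s

theorem finite_iterate_pred_eq_and_ncard_le [NeZero q] (c : Tree q) (n : ℕ) :
    {y | pred^[n] y = c}.Finite ∧ {y | pred^[n] y = c}.ncard ≤ q ^ n := by
  induction n with
  | zero => simp
  | succ n ih =>
    have h : {y | pred^[n + 1] y = c} =
        (fun p : Tree q × ZMod q => p.1.succ p.2) '' ({y | pred^[n] y = c} ×ˢ Set.univ) := by
      ext y
      simp only [Set.mem_ofPred_eq, Set.mem_image, Set.mem_prod, Set.mem_univ, and_true,
        Prod.exists]
      constructor
      · intro h
        exact ⟨y.pred, _, by rwa [Function.iterate_succ_apply] at h, succ_pred y⟩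
      · rintro ⟨z, s, hz, rfl⟩
        rwa [Function.iterate_succ_apply, pred_succ]
    have hf : ({y | pred^[n] y = c} ×ˢ (Set.univ : Set (ZMod q))).Finite :=
      ih.1.prod Set.finite_univ
    rw [h]
    refine ⟨hf.image _, (Set.ncard_image_le hf).trans ?_⟩
    rw [Set.ncard_prod, Set.ncard_univ, Nat.card_eq_fintype_card, ZMod.card, pow_succ]
    exact Nat.mul_le_mul_right _ ih.2

open Classical in
/-- The function on the vertices at distance `i + 1` below `c⁻` that is constant on the branches
at `c⁻`, has mean zero, and singles out the branch of `c`. -/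
noncomputable def branch (c : Tree q) (i : ℕ) (y : Tree q) : ℝ :=
  (if pred^[i] y = c then 1 else 0) - (if pred^[i + 1] y = pred c then 1 else 0) / q

theorem branch_pred (c : Tree q) (i : ℕ) (y : Tree q) : branch c i y.pred = branch c (i + 1) y := by
  rfl

theorem sum_branch_succ [NeZero q] (c : Tree q) (i : ℕ) (y : Tree q) :
    ∑ s, branch c (i + 1) (succ y s) = q * branch c i y := by
  have : ∀ s, branch c (i + 1) (succ y s) = branch c i y := fun s => by
    rw [← branch_pred, pred_succ]
  simp [this, ZMod.card]

/-- Mean zero over the children of `c⁻`: this is the Dirichlet condition at the end of the path. -/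
theorem sum_branch_zero_succ [NeZero q] (c : Tree q) (y : Tree q) :
    ∑ s, branch c 0 (succ y s) = 0 := by
  classical
  have hq : (q : ℝ) ≠ 0 := Nat.cast_ne_zero.2 (NeZero.ne q)
  have hb : ∀ s, branch c 0 (succ y s) =
      (if succ y s = c then 1 else 0) - (if y = pred c then 1 else 0) / q := fun s => by
    have h := pred_succ y s
    rw [branch, zero_add, Function.iterate_one, Function.iterate_zero, id]
    simp only [h]
  simp only [hb, Finset.sum_sub_distrib, Finset.sum_const, Finset.card_univ, ZMod.card, nsmul_eq_mul]
  rw [mul_div_cancel₀ _ hq, sub_eq_zero]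
  split_ifs with h
  · obtain ⟨s, rfl⟩ := (pred_eq_iff y c).1 h.symm
    rw [Finset.sum_eq_single s]
    · simp
    · intro t _ ht
      rw [if_neg fun h => ht (succ_injective _ h)]
    · simp
  · refine Finset.sum_eq_zero fun s _ => if_neg ?_
    rintro rfl
    exact h (pred_succ _ _).symm

theorem branch_eq_zero (c : Tree q) (i : ℕ) (y : Tree q) (h : pred^[i + 1] y ≠ pred c) :
    branch c i y = 0 := by
  have h' : pred^[i] y ≠ c := fun h' => h (by rw [Function.iterate_succ_apply', h'])
  rw [branch, if_neg h', if_neg h, zero_div, sub_zero]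

theorem abs_branch_le [NeZero q] (c : Tree q) (i : ℕ) (y : Tree q) : |branch c i y| ≤ 1 := by
  have hq : (1 : ℝ) ≤ q := by exact_mod_cast NeZero.one_le
  have h1 : (1 : ℝ) / q ≤ 1 := by rw [div_le_one (by linarith)]; exact hq
  have h0 : (0 : ℝ) ≤ 1 / q := by positivity
  by_cases h : pred^[i + 1] y = pred c
  · rw [branch, abs_le]
    split_ifs <;> constructor <;> linarith
  · rw [branch_eq_zero c i y h]
    simp

/-- `(q - 1)` off zero, and `-1` at zero. -/
noncomputable def branchCoeff (q k : ℕ) : ℝ := if 0 < k then (q : ℝ) - 1 else -1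

/-- The value is nonzero only if `pred^[k + 1] x` is the ancestor of `o` at height `i + 1`. If it is
the confluent and `x` lies strictly below it, `x` and `o` lie in different branches and only `-1/q`
survives; higher up they share a branch and the value is `1 - 1/q`. -/
theorem branch_iterate_pred_root [NeZero q] (x : Tree q) (k i : ℕ) :
    branch (pred^[k] x) i (root q) =
      if dn x ≤ k + 1 ∧ i + 1 + dn x = k + 1 + up x then branchCoeff q (k + 1 - dn x) / q
      else 0 := by
  have hq : (q : ℝ) ≠ 0 := Nat.cast_ne_zero.2 (NeZero.ne q)
  rw [branch, ← Function.iterate_succ_apply' pred, eq_comm,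
    eq_comm (a := pred^[i] _), eq_comm (a := pred^[i + 1] _)]
  simp only [iterate_pred_eq_root_iff]
  by_cases h : dn x ≤ k + 1 ∧ i + 1 + dn x = k + 1 + up x
  · by_cases h' : dn x ≤ k ∧ i + dn x = k + up x
    · rw [if_pos h, if_pos h, if_pos h', branchCoeff, if_pos (by omega)]
      field_simp
    · rw [if_pos h, if_pos h, if_neg h', branchCoeff, if_neg (by omega)]
      ring
  · rw [if_neg h, if_neg h, if_neg (by omega)]
    simp

/-- The series telescopes: its `k`-th term is `t k - t (k + 1)` with `t k = q^{-k}` if the `k`-th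
ancestors of `x` and `y` agree and `0` otherwise, and `t` tends to `0`. -/
theorem hasSum_branch [NeZero q] (hq : 2 ≤ q) (x y : Tree q) [Decidable (y = x)] :
    HasSum (fun k : ℕ => ((q : ℝ) ^ k)⁻¹ * branch (pred^[k] x) k y) (if y = x then 1 else 0) ∧
    Summable fun k : ℕ => ‖((q : ℝ) ^ k)⁻¹ * branch (pred^[k] x) k y‖ := by
  classical
  have hq' : (q : ℝ) ≠ 0 := Nat.cast_ne_zero.2 (NeZero.ne q)
  have hq1 : (q : ℝ)⁻¹ < 1 := inv_lt_one_of_one_lt₀ (by exact_mod_cast hq)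
  have hs : Summable fun k : ℕ => ‖((q : ℝ) ^ k)⁻¹ * branch (pred^[k] x) k y‖ := by
    refine Summable.of_nonneg_of_le (fun _ => norm_nonneg _) (fun k => ?_)
      (summable_geometric_of_lt_one (by positivity) hq1)
    rw [norm_mul, inv_pow, Real.norm_of_nonneg (by positivity : (0 : ℝ) ≤ ((q : ℝ) ^ k)⁻¹)]
    exact mul_le_of_le_one_right (by positivity) (abs_branch_le _ _ _)
  refine ⟨?_, hs⟩
  let t : ℕ → ℝ := fun k => ((q : ℝ) ^ k)⁻¹ * if pred^[k] y = pred^[k] x then 1 else 0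
  have hsum : ∀ n, ∑ k ∈ Finset.range n, ((q : ℝ) ^ k)⁻¹ * branch (pred^[k] x) k y
      = t 0 - t n := by
    intro n
    rw [← Finset.sum_range_sub']
    refine Finset.sum_congr rfl fun k _ => ?_
    simp only [t, branch, ← Function.iterate_succ_apply' pred, pow_succ]
    field_simp
  have ht : Filter.Tendsto t Filter.atTop (nhds 0) := by
    refine squeeze_zero (g := fun k => ((q : ℝ)⁻¹) ^ k) (fun k => ?_) (fun k => ?_)
      (tendsto_pow_atTop_nhds_zero_of_lt_one (by positivity) hq1)
    · simp only [t]; split_ifs <;> positivity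
    · simp only [t, inv_pow]
      split_ifs
      · simp
      · simp
  rw [hs.of_norm.hasSum_iff_tendsto_nat]
  simp only [hsum]
  have := ht.const_sub (t 0)
  rw [sub_zero] at this
  convert this using 2
  simp [t]

end Tree

/-! ### Projection-valued measures acting on eigenvectors -/

theorem measure_compl_singleton_eq_zero_of_moments {μ : Measure ℝ} {t c : ℝ}
    (hi : ∀ N : ℕ, Integrable (fun s : ℝ => s ^ N) μ)
    (hint : ∀ N : ℕ, ∫ s, s ^ N ∂μ = t ^ N * c) : μ {t}ᶜ = 0 := by
  have heq : (fun s : ℝ => (s - t) ^ 2) = fun s => s ^ 2 - 2 * t * s ^ 1 + t ^ 2 * s ^ 0 := by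
    funext s
    ring
  have hi1 : Integrable (fun s : ℝ => 2 * t * s ^ 1) μ := (hi 1).const_mul _
  have hi0 : Integrable (fun s : ℝ => t ^ 2 * s ^ 0) μ := (hi 0).const_mul _
  have hi21 : Integrable (fun s : ℝ => s ^ 2 - 2 * t * s ^ 1) μ := (hi 2).sub hi1
  have hi2 : Integrable (fun s : ℝ => (s - t) ^ 2) μ := by
    rw [heq]
    exact hi21.add hi0
  -- The moments of order 0, 1 and 2 alone make the second moment about `t` vanish.
  have h0 : ∫ s, (s - t) ^ 2 ∂μ = 0 := by
    rw [heq, integral_add hi21 hi0, integral_sub (hi 2) hi1, integral_const_mul,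
      integral_const_mul, hint, hint, hint]
    ring
  rw [integral_eq_zero_iff_of_nonneg (fun s => by positivity) hi2] at h0
  rw [← mem_ae_iff]
  filter_upwards [h0] with s hs
  have : s - t = 0 := by simpa using hs
  simpa using sub_eq_zero.1 this

section Spectral

variable {H : Type*} [NormedAddCommGroup H] [InnerProductSpace ℂ H] [CompleteSpace H]

theorem inner_self_starProjection {p : H →L[ℂ] H} (hp : IsStarProjection p) (v : H) :
    ⟪v, p v⟫_ℂ = ((‖p v‖ ^ 2 : ℝ) : ℂ) := by
  have h1 : p (p v) = p v := congrArg (fun T : H →L[ℂ] H => T v) hp.isIdempotentElem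
  have h2 : ContinuousLinearMap.adjoint p = p := hp.isSelfAdjoint
  rw [← h1, ← ContinuousLinearMap.adjoint_inner_left, h2, inner_self_eq_norm_sq_to_K, h1]
  norm_cast

namespace ProjectionValuedMeasure

variable (E : ProjectionValuedMeasure H)

theorem apply_add_apply_compl (v : H) {B : Set ℝ} (hB : MeasurableSet B) :
    E.toFun B v + E.toFun Bᶜ v = v := by
  refine ext_inner_left ℂ fun u => ?_
  have h := (E.matrixElement u v).of_compl hB
  rw [E.matrixElement_apply _ _ hB.compl, E.matrixElement_apply _ _ hB,
    E.matrixElement_apply _ _ MeasurableSet.univ, E.univ] at h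
  rw [inner_add_right, h]
  simp

theorem diagonal_apply' (v : H) {B : Set ℝ} (hB : MeasurableSet B) :
    E.diagonal v B = ENNReal.ofReal (‖E.toFun B v‖ ^ 2) := by
  rw [E.diagonal_apply v hB, inner_self_starProjection (E.isStarProjection B hB), Complex.ofReal_re]

instance (v : H) : IsFiniteMeasure (E.diagonal v) :=
  ⟨by rw [E.diagonal_apply v MeasurableSet.univ]; exact ENNReal.ofReal_lt_top⟩

theorem diagonal_eq_zero_iff (v : H) {B : Set ℝ} (hB : MeasurableSet B) :
    E.diagonal v B = 0 ↔ E.toFun B v = 0 := by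
  rw [E.diagonal_apply' v hB, ENNReal.ofReal_eq_zero]
  constructor
  · intro h
    have := le_antisymm h (by positivity)
    simpa using this
  · intro h
    simp [h]

theorem integrable_pow {A : H →L[ℂ] H} (hE : E.toFun (spectrum ℝ A)ᶜ = 0) (v : H) (N : ℕ) :
    Integrable (fun t : ℝ => t ^ N) (E.diagonal v) := by
  have hc : IsCompact (spectrum ℝ A) := spectrum.isCompact A
  obtain ⟨C, hC⟩ := hc.exists_bound_of_continuousOn (f := fun t : ℝ => t ^ N) (by fun_prop)
  refine Integrable.of_bound (by fun_prop) C ?_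
  have h : E.diagonal v (spectrum ℝ A)ᶜ = 0 := by
    rw [E.diagonal_eq_zero_iff v hc.measurableSet.compl, hE]
    rfl
  filter_upwards [compl_mem_ae_iff.2 h] with t ht
  exact hC t (by simpa using ht)

/-- The moments of `E.diagonal v` are those of `‖v‖²` times the point mass at `t`, so it lives on
`{t}`. This needs no uniqueness theorem for `E`. -/
theorem apply_compl_singleton {A : H →L[ℂ] H} (hE : IsResolutionOfIdentity A E) {v : H} {t : ℝ}
    (hv : A v = (t : ℂ) • v) : E.toFun {t}ᶜ v = 0 := by
  have hi := E.integrable_pow hE.1 v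
  have hpow : ∀ N : ℕ, (A ^ N) v = ((t ^ N : ℝ) : ℂ) • v := by
    intro N
    induction N with
    | zero => simp
    | succ N ih =>
      rw [pow_succ, mul_apply_eq_comp, hv, map_smul, ih, smul_smul, pow_succ]
      push_cast
      ring_nf
  have hint : ∀ N : ℕ, ∫ s, s ^ N ∂(E.diagonal v) = t ^ N * ‖v‖ ^ 2 := by
    intro N
    have h := hE.2 N v
    rw [hpow, inner_smul_right, inner_self_eq_norm_sq_to_K] at h
    refine Complex.ofReal_injective (h.symm.trans ?_)
    push_cast
    rfl
  rw [← E.diagonal_eq_zero_iff v (measurableSet_singleton t).compl]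
  exact measure_compl_singleton_eq_zero_of_moments hi hint

/-- A resolution of the identity acts on an eigenvector by the indicator of the eigenvalue. -/
theorem apply_eigenvector {A : H →L[ℂ] H} (hE : IsResolutionOfIdentity A E) {v : H} {t : ℝ}
    (hv : A v = (t : ℂ) • v) {B : Set ℝ} (hB : MeasurableSet B) :
    E.toFun B v = (B.indicator (fun _ => (1 : ℂ)) t) • v := by
  have h0 := E.apply_compl_singleton hE hv
  -- A set avoiding `t` lies in `{t}ᶜ`, so `E(C) = E(C) E({t}ᶜ)`.
  have key : ∀ C : Set ℝ, MeasurableSet C → t ∉ C → E.toFun C v = 0 := by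
    intro C hC ht
    have h := E.inter C {t}ᶜ hC (measurableSet_singleton t).compl
    rw [inter_eq_left.2 (subset_compl_singleton_iff.2 ht)] at h
    rw [h, mul_apply_eq_comp, h0, map_zero]
  by_cases ht : t ∈ B
  · have h := E.apply_add_apply_compl v hB
    rw [key Bᶜ hB.compl (by simpa using ht), add_zero] at h
    rw [h, indicator_of_mem ht, one_smul]
  · rw [key B hB ht, indicator_of_notMem ht, zero_smul]

end ProjectionValuedMeasure

/-! ### Existence for a symmetric operator with a total set of eigenvectors -/

/-- The eigenvectors of `A` with eigenvalue in `B`. -/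
def eigenvectors (A : H →L[ℂ] H) (B : Set ℝ) : Set H := {v | ∃ t ∈ B, A v = (t : ℂ) • v}

/-- The orthogonal projection onto the closed span of the eigenvectors with eigenvalue in `B`. -/
noncomputable def eigenProjection (A : H →L[ℂ] H) (B : Set ℝ) : H →L[ℂ] H :=
  (Submodule.span ℂ (eigenvectors A B)).topologicalClosure.starProjection

variable {A : H →L[ℂ] H}

/-- By symmetry of `A`, eigenvectors with different real eigenvalues are orthogonal. -/
theorem eigenProjection_apply (hA : (A : H →ₗ[ℂ] H).IsSymmetric) {v : H} {t : ℝ}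
    (hv : A v = (t : ℂ) • v) (B : Set ℝ) :
    eigenProjection A B v = (B.indicator (fun _ => (1 : ℂ)) t) • v := by
  by_cases ht : t ∈ B
  · rw [indicator_of_mem ht, one_smul, eigenProjection, Submodule.starProjection_eq_self_iff]
    exact Submodule.le_topologicalClosure _ (Submodule.subset_span ⟨t, ht, hv⟩)
  · rw [indicator_of_notMem ht, zero_smul, eigenProjection,
      Submodule.starProjection_apply_eq_zero_iff, Submodule.orthogonal_closure]
    have hle : Submodule.span ℂ (eigenvectors A B) ≤ (Submodule.span ℂ {v})ᗮ := by
      rw [Submodule.span_le]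
      rintro u ⟨s, hs, hu⟩
      rw [SetLike.mem_coe, Submodule.mem_orthogonal_singleton_iff_inner_left]
      have h := hA u v
      simp only [ContinuousLinearMap.coe_coe] at h
      rw [hu, hv, inner_smul_left, inner_smul_right, Complex.conj_ofReal, ← sub_eq_zero,
        ← sub_mul] at h
      rcases mul_eq_zero.1 h with h | h
      · rw [sub_eq_zero] at h
        exact absurd (Complex.ofReal_injective h ▸ hs) ht
      · exact h
    rw [Submodule.mem_orthogonal]
    intro u hu
    exact (Submodule.mem_orthogonal_singleton_iff_inner_left).1 (hle hu)

-- Reduces identities between bounded operators to scalar identities on eigenvectors.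
omit [CompleteSpace H] in
theorem ext_eigenvectors {S : Set ℝ}
    (hd : Dense (Submodule.span ℂ (eigenvectors A S) : Set H)) {T T' : H →L[ℂ] H}
    (h : ∀ v, ∀ t ∈ S, A v = (t : ℂ) • v → T v = T' v) : T = T' :=
  ContinuousLinearMap.ext_on hd fun v ⟨t, ht, hv⟩ => h v t ht hv

theorem norm_eigenProjection_le (B : Set ℝ) : ‖eigenProjection A B‖ ≤ 1 :=
  Submodule.starProjection_norm_le _

/-- On the span of eigenvectors the claim is trivial, as each eigenvalue lies in at most one `f i`.
An `ε/3` argument extends it to the closure. -/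
theorem hasSum_eigenProjection (hA : (A : H →ₗ[ℂ] H).IsSymmetric) {S : Set ℝ}
    (hd : Dense (Submodule.span ℂ (eigenvectors A S) : Set H)) {ι : Type*} {f : ι → Set ℝ}
    (hf : Pairwise (Function.onFun Disjoint f)) (v : H) :
    HasSum (fun i => eigenProjection A (f i) v) (eigenProjection A (⋃ i, f i) v) := by
  classical
  have hind : ∀ (t : ℝ) (i : ι), t ∈ f i → ∀ j, j ≠ i → t ∉ f j := fun t i hi j hj hj' =>
    Set.disjoint_left.1 (hf hj) hj' hi
  -- Partial sums are again eigenprojections, hence of norm at most 1 uniformly in `s`.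
  have hpart : ∀ s : Finset ι, ∑ i ∈ s, eigenProjection A (f i) =
      eigenProjection A (⋃ i ∈ s, f i) := by
    intro s
    refine ext_eigenvectors hd fun v t _ hv => ?_
    rw [sum_apply, eigenProjection_apply hA hv]
    simp only [eigenProjection_apply hA hv, ← Finset.sum_smul]
    congr 1
    by_cases h : ∃ i ∈ s, t ∈ f i
    · obtain ⟨i, hi, hti⟩ := h
      rw [Finset.sum_eq_single i, indicator_of_mem hti, indicator_of_mem]
      · simp only [mem_iUnion]
        exact ⟨i, hi, hti⟩
      · exact fun j _ hj => indicator_of_notMem (hind t i hti j hj) _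
      · exact fun h => absurd hi h
    · rw [indicator_of_notMem (by simpa using h)]
      push Not at h
      exact Finset.sum_eq_zero fun i hi => indicator_of_notMem (h i hi) _
  have hspan : ∀ w ∈ Submodule.span ℂ (eigenvectors A S),
      HasSum (fun i => eigenProjection A (f i) w) (eigenProjection A (⋃ i, f i) w) := by
    intro w hw
    induction hw using Submodule.span_induction with
    | mem w hw =>
      obtain ⟨t, _, hw⟩ := hw
      simp only [eigenProjection_apply hA hw]
      by_cases h : ∃ i, t ∈ f i
      · obtain ⟨i, hi⟩ := h
        have := hasSum_single (f := fun i => (f i).indicator (fun _ => (1 : ℂ)) t • w) i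
          fun j hj => by rw [indicator_of_notMem (hind t i hi j hj), zero_smul]
        rw [indicator_of_mem (mem_iUnion.2 ⟨i, hi⟩)]
        rwa [indicator_of_mem hi] at this
      · push Not at h
        rw [indicator_of_notMem (by simp [h])]
        simp only [indicator_of_notMem (h _), zero_smul]
        exact hasSum_zero
    | zero => simp
    | add u w _ _ hu hw => simpa only [map_add] using hu.add hw
    | smul c w _ hw => simpa only [map_smul] using hw.const_smul c
  rw [HasSum, SummationFilter.unconditional_filter, Metric.tendsto_nhds]
  intro ε hε
  obtain ⟨w, hw, hvw⟩ := Metric.dense_iff.1 hd v (ε / 3) (by positivity)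
  rw [Metric.mem_ball, dist_comm] at hw
  have h := hspan w hvw
  rw [HasSum, SummationFilter.unconditional_filter, Metric.tendsto_nhds] at h
  filter_upwards [h (ε / 3) (by positivity)] with s hs
  have hle : ∀ B, dist (eigenProjection A B v) (eigenProjection A B w) ≤ dist v w := by
    intro B
    rw [dist_eq_norm, dist_eq_norm, ← map_sub]
    exact ((eigenProjection A B).le_of_opNorm_le (norm_eigenProjection_le B) _).trans_eq (one_mul _)
  rw [← sum_apply, hpart] at hs ⊢
  calc _ ≤ _ := dist_triangle4 _ (eigenProjection A (⋃ i ∈ s, f i) w)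
        (eigenProjection A (⋃ i, f i) w) _
    _ < ε / 3 + ε / 3 + ε / 3 := by
      gcongr
      · exact (hle _).trans_lt hw
      · rw [dist_comm]
        exact (hle _).trans_lt hw
    _ = ε := by ring

/-- The projection-valued measure of a symmetric operator with a total set of eigenvectors. -/
noncomputable def eigenMeasure (hA : (A : H →ₗ[ℂ] H).IsSymmetric) {S : Set ℝ}
    (hd : Dense (Submodule.span ℂ (eigenvectors A S) : Set H)) : ProjectionValuedMeasure H where
  toFun := eigenProjection A
  isStarProjection _ _ := isStarProjection_starProjection
  univ := ext_eigenvectors hd fun v t _ hv => by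
    rw [eigenProjection_apply hA hv, indicator_of_mem (mem_univ t), one_smul]
    rfl
  inter B C _ _ := ext_eigenvectors hd fun v t _ hv => by
    rw [mul_apply_eq_comp, eigenProjection_apply hA hv, eigenProjection_apply hA hv,
      map_smul, eigenProjection_apply hA hv, smul_smul, ← inter_indicator_mul, inter_comm]
    simp
  iUnion _ _ hf v := hasSum_eigenProjection hA hd hf v

/-- Since `S` is countable, `E.diagonal v` is discrete with mass `‖P_t v‖²` at `t`, where `P_t` is
the eigenprojection of `{t}`. The moment integral is then the series obtained by expanding `v = ∑
P_t v` in `⟨v, A^N v⟩`. -/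
theorem isResolutionOfIdentity_eigenMeasure (hA : (A : H →ₗ[ℂ] H).IsSymmetric) {S : Set ℝ}
    (hS : S.Countable) (hd : Dense (Submodule.span ℂ (eigenvectors A S) : Set H)) :
    IsResolutionOfIdentity A (eigenMeasure hA hd) := by
  have hspec : (eigenMeasure hA hd).toFun (spectrum ℝ A)ᶜ = 0 := by
    refine ext_eigenvectors hd fun v t _ hv => ?_
    rw [eigenMeasure, eigenProjection_apply hA hv]
    by_cases ht : t ∈ spectrum ℝ A
    · rw [indicator_of_notMem (by simpa using ht), zero_smul]
      rfl
    · obtain ⟨u, hu⟩ := spectrum.notMem_iff.1 ht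
      have h : (u : H →L[ℂ] H) v = 0 := by
        rw [hu, sub_apply, hv, Algebra.algebraMap_eq_smul_one,
          smul_apply, one_apply_eq_self, sub_eq_zero]
        rfl
      have hv0 : v = 0 := by
        calc v = ((↑u⁻¹ * ↑u : H →L[ℂ] H)) v := by rw [Units.inv_mul]; rfl
          _ = 0 := by rw [mul_apply_eq_comp, h, map_zero]
      simp [hv0]
  refine ⟨hspec, fun N v => ?_⟩
  have hAN : ∀ t : ℝ, A ^ N * eigenProjection A {t} = ((t ^ N : ℝ) : ℂ) • eigenProjection A {t} := by
    intro t
    refine ext_eigenvectors hd fun v s _ hv => ?_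
    rw [mul_apply_eq_comp, smul_apply, eigenProjection_apply hA hv]
    by_cases hs : s = t
    · subst hs
      rw [indicator_of_mem (mem_singleton s), one_smul]
      clear * - hv
      induction N with
      | zero => simp
      | succ N ih =>
        rw [pow_succ, mul_apply_eq_comp, hv, map_smul, ih, smul_smul, pow_succ]
        push_cast
        ring_nf
    · rw [indicator_of_notMem (by simpa using hs)]
      simp
  have hdisj : Pairwise (Function.onFun Disjoint fun t : S => ({(t : ℝ)} : Set ℝ)) := by
    intro s t hst
    simpa [Function.onFun] using fun h => hst (Subtype.ext h)
  have hall : eigenProjection A S = 1 := ext_eigenvectors hd fun v t ht hv => by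
    rw [eigenProjection_apply hA hv, indicator_of_mem ht, one_smul]
    rfl
  have hsum := hasSum_eigenProjection hA hd hdisj v
  rw [iUnion_of_singleton_coe, hall] at hsum
  have key : ∀ t : ℝ, ⟪v, (A ^ N) (eigenProjection A {t} v)⟫_ℂ =
      ((t ^ N * ‖eigenProjection A {t} v‖ ^ 2 : ℝ) : ℂ) := by
    intro t
    have := congrArg (fun T : H →L[ℂ] H => ⟪v, T v⟫_ℂ) (hAN t)
    simp only [mul_apply_eq_comp, smul_apply, inner_smul_right] at this
    have hp : IsStarProjection (eigenProjection A {t}) := isStarProjection_starProjection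
    rw [Complex.ofReal_mul, ← inner_self_starProjection hp]
    exact this
  have h1 : HasSum (fun t : S => ⟪v, (A ^ N) (eigenProjection A {(t : ℝ)} v)⟫_ℂ)
      ⟪v, (A ^ N) v⟫_ℂ := hsum.mapL ((innerSL ℂ v).comp (A ^ N))
  simp only [key] at h1
  rw [← h1.tsum_eq, ← Complex.ofReal_tsum]
  congr 1
  set E := eigenMeasure hA hd with hE
  have hSc : E.diagonal v Sᶜ = 0 := by
    rw [E.diagonal_eq_zero_iff v hS.measurableSet.compl]
    have : E.toFun Sᶜ = 0 := ext_eigenvectors hd fun v t ht hv => by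
      rw [hE, eigenMeasure, eigenProjection_apply hA hv, indicator_of_notMem (by simpa using ht),
        zero_smul]
      rfl
    rw [this]
    rfl
  have hi := E.integrable_pow hspec v N
  have hres : (E.diagonal v).restrict S = E.diagonal v :=
    Measure.restrict_eq_self_of_ae_mem (mem_ae_iff.2 hSc)
  rw [← hres, setIntegral_countable _ hS hi.integrableOn]
  refine tsum_congr fun t => ?_
  rw [measureReal_def, E.diagonal_apply' v (measurableSet_singleton _),
    ENNReal.toReal_ofReal (by positivity), smul_eq_mul, mul_comm]
  rfl

end Spectral

/-! ### Finite sums of sines -/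

theorem sum_range_cos {n : ℕ} {a : ℝ} (h0 : 0 < a) (hn : a < 2 * n)
    (ha : Real.sin (a * Real.pi) = 0) :
    ∑ m ∈ Finset.range n, Real.cos (a * ((m : ℝ) / n * Real.pi)) =
      (1 - Real.cos (a * Real.pi)) / 2 := by
  have hn0 : (0 : ℝ) < n := by linarith
  -- Multiplying by `2 sin β` makes the cosine sum telescope; the bounds on `a` put `β` in `(0, π)`,
  -- so `sin β ≠ 0`.
  set β := a * Real.pi / (2 * n) with hβ
  have hpi := Real.pi_pos
  have hs : 0 < Real.sin β := by
    apply Real.sin_pos_of_pos_of_lt_pi (by positivity)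
    rw [hβ, div_lt_iff₀ (by positivity)]
    nlinarith
  have key : ∀ k : ℕ, 2 * Real.sin β * ∑ m ∈ Finset.range k, Real.cos (2 * m * β) =
      Real.sin ((2 * k - 1) * β) + Real.sin β := by
    intro k
    induction k with
    | zero => simp
    | succ k ih =>
      rw [Finset.sum_range_succ, mul_add, ih]
      have e1 : (2 * ((k + 1 : ℕ) : ℝ) - 1) * β = 2 * k * β + β := by push_cast; ring
      have e2 : (2 * (k : ℝ) - 1) * β = 2 * k * β - β := by ring
      rw [e1, e2, Real.sin_add, Real.sin_sub]
      ring
  have h := key n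
  have e : (2 * (n : ℝ) - 1) * β = a * Real.pi - β := by rw [hβ]; field_simp
  rw [e, Real.sin_sub, ha] at h
  have e' : ∀ m : ℕ, a * ((m : ℝ) / n * Real.pi) = 2 * m * β := fun m => by rw [hβ]; field_simp
  simp only [e']
  apply mul_left_cancel₀ (mul_pos two_pos hs).ne'
  rw [h]
  ring

/-- Product-to-sum: for `i ≠ j` the two cosine sums agree because `i - j` and `i + j` have the same
parity; for `i = j` they are `n` and `0`. -/
theorem sum_range_sin_mul_sin {n i j : ℕ} (hi : 0 < i) (hin : i < n) (hj : 0 < j) (hjn : j < n) :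
    ∑ m ∈ Finset.range n, Real.sin (i * ((m : ℝ) / n * Real.pi)) *
      Real.sin (j * ((m : ℝ) / n * Real.pi)) = if i = j then (n : ℝ) / 2 else 0 := by
  have hi' : (0 : ℝ) < i := by exact_mod_cast hi
  have hin' : (i : ℝ) < n := by exact_mod_cast hin
  have hj' : (0 : ℝ) < j := by exact_mod_cast hj
  have hjn' : (j : ℝ) < n := by exact_mod_cast hjn
  have hsi := Real.sin_nat_mul_pi i
  have hsj := Real.sin_nat_mul_pi j
  have hsum : ∀ x : ℝ, Real.sin (i * x) * Real.sin (j * x) =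
      (Real.cos (((i : ℝ) - j) * x) - Real.cos (((i : ℝ) + j) * x)) / 2 := by
    intro x
    rw [sub_mul, add_mul, Real.cos_sub, Real.cos_add]
    ring
  simp only [hsum]
  rw [← Finset.sum_div, Finset.sum_sub_distrib, sum_range_cos (a := (i : ℝ) + j) (by positivity)
    (by linarith) (by rw [add_mul, Real.sin_add, hsi, hsj]; ring), add_mul, Real.cos_add, hsi, hsj]
  split_ifs with h
  · subst h
    have := Real.sin_sq_add_cos_sq (i * Real.pi)
    rw [hsi] at this
    have h1 : Real.cos (i * Real.pi) * Real.cos (i * Real.pi) = 1 := by nlinarith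
    simp [h1]
  · have hcos : ∑ m ∈ Finset.range n, Real.cos (((i : ℝ) - j) * ((m : ℝ) / n * Real.pi)) =
        (1 - Real.cos (i * Real.pi) * Real.cos (j * Real.pi)) / 2 := by
      rcases lt_or_gt_of_ne h with h | h
      · have h' : (i : ℝ) < j := by exact_mod_cast h
        have e : ∀ x : ℝ, Real.cos (((i : ℝ) - j) * x) = Real.cos (((j : ℝ) - i) * x) := by
          intro x
          rw [← Real.cos_neg]
          ring_nf
        simp only [e]
        rw [sum_range_cos (by linarith) (by linarith)
          (by rw [sub_mul, Real.sin_sub, hsi, hsj]; ring), sub_mul, Real.cos_sub, hsi, hsj]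
        ring
      · have h' : (j : ℝ) < i := by exact_mod_cast h
        rw [sum_range_cos (by linarith) (by linarith)
          (by rw [sub_mul, Real.sin_sub, hsi, hsj]; ring), sub_mul, Real.cos_sub, hsi, hsj]
        ring
    rw [hcos]
    ring

/-- The sequence `0, A 0, A 1, …`. -/
def shiftSeq (A : ℕ → ℝ) : ℕ → ℝ
  | 0 => 0
  | a + 1 => A a

/-- The eigenvalue equation on the weighted path. Shifting the index in each half reduces it to
`sin((a+2)θ) + sin(aθ) = 2 cos θ sin((a+1)θ)`; the boundary terms drop out by `sin 0 = 0` at one end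
and by `hθ` at the other. -/
theorem sum_antidiagonal_sin {q r κ w θ : ℝ} {N : ℕ} (hq : q * w = κ) (hr : κ * w = r)
    (hθ : Real.sin ((N + 2 : ℕ) * θ) = 0) (A B : ℕ → ℝ) :
    ∑ p ∈ antidiagonal N, w ^ p.1 * Real.sin ((p.1 + 1 : ℕ) * θ) *
      (q * shiftSeq A p.1 * B (p.2 + 1) + r * A (p.1 + 1) * shiftSeq B p.2) =
    2 * κ * Real.cos θ * ∑ p ∈ antidiagonal N, w ^ p.1 * Real.sin ((p.1 + 1 : ℕ) * θ) *
      (A p.1 * B p.2) := by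
  have htrig : ∀ a : ℕ, Real.sin ((a + 2 : ℕ) * θ) + Real.sin ((a : ℕ) * θ) =
      2 * Real.cos θ * Real.sin ((a + 1 : ℕ) * θ) := by
    intro a
    have e1 : ((a + 2 : ℕ) : ℝ) * θ = ((a + 1 : ℕ) : ℝ) * θ + θ := by push_cast; ring
    have e2 : (a : ℝ) * θ = ((a + 1 : ℕ) : ℝ) * θ - θ := by push_cast; ring
    rw [e1, e2, Real.sin_add, Real.sin_sub]
    ring
  cases N with
  | zero =>
    -- A one-vertex path: the left side is zero, and so is `2 cos θ sin θ = sin 2θ`.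
    have h := htrig 0
    simp only [zero_add, Nat.cast_zero, zero_mul, Real.sin_zero] at h hθ
    rw [hθ] at h
    simp only [Finset.Nat.antidiagonal_zero, Finset.sum_singleton, shiftSeq]
    linear_combination (κ * A 0 * B 0) * h
  | succ M =>
    have h1 : ∑ p ∈ antidiagonal (M + 1), w ^ p.1 * Real.sin ((p.1 + 1 : ℕ) * θ) *
        (q * shiftSeq A p.1 * B (p.2 + 1)) = κ * ∑ p ∈ antidiagonal (M + 1),
          w ^ p.1 * Real.sin ((p.1 + 2 : ℕ) * θ) * (A p.1 * B p.2) := by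
      rw [Finset.Nat.sum_antidiagonal_succ, Finset.Nat.sum_antidiagonal_succ']
      simp only [shiftSeq, hθ, mul_zero, zero_mul, zero_add, Finset.mul_sum]
      refine Finset.sum_congr rfl fun p _ => ?_
      rw [← hq]
      ring_nf
    have h2 : ∑ p ∈ antidiagonal (M + 1), w ^ p.1 * Real.sin ((p.1 + 1 : ℕ) * θ) *
        (r * A (p.1 + 1) * shiftSeq B p.2) = κ * ∑ p ∈ antidiagonal (M + 1),
          w ^ p.1 * Real.sin ((p.1 : ℕ) * θ) * (A p.1 * B p.2) := by
      rw [Finset.Nat.sum_antidiagonal_succ', Finset.Nat.sum_antidiagonal_succ]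
      simp only [shiftSeq, mul_zero, zero_mul, zero_add, Finset.mul_sum, Nat.cast_zero,
        Real.sin_zero]
      refine Finset.sum_congr rfl fun p _ => ?_
      rw [← hr]
      ring_nf
    simp only [mul_add (_ * _), Finset.sum_add_distrib]
    rw [h1, h2, ← mul_add, ← Finset.sum_add_distrib, mul_right_comm 2 κ, mul_comm _ κ, mul_assoc κ]
    congr 1
    rw [Finset.mul_sum]
    refine Finset.sum_congr rfl fun p _ => ?_
    linear_combination (w ^ p.1 * (A p.1 * B p.2)) * htrig p.1

/-! ### Finitely supported vectors -/

section FiniteSupport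

variable {V : Type*}

theorem sum_norm_sq_le {f : V → ℂ} {S : Set V} (hS : S.Finite) {C : ℝ}
    (h0 : ∀ x ∉ S, f x = 0) (hC : ∀ x, ‖f x‖ ≤ C) (s : Finset V) :
    ∑ x ∈ s, ‖f x‖ ^ (2 : ℝ≥0∞).toReal ≤ (√S.ncard * C) ^ (2 : ℝ≥0∞).toReal := by
  classical
  have h2 : (2 : ℝ≥0∞).toReal = ((2 : ℕ) : ℝ) := by norm_num
  simp only [h2, Real.rpow_natCast]
  rw [mul_pow, Real.sq_sqrt (by positivity), Set.ncard_eq_toFinset_card S hS]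
  calc ∑ x ∈ s, ‖f x‖ ^ 2 ≤ ∑ x ∈ s ∪ hS.toFinset, ‖f x‖ ^ 2 :=
        Finset.sum_le_sum_of_subset_of_nonneg Finset.subset_union_left fun _ _ _ => by positivity
    _ = ∑ x ∈ hS.toFinset, ‖f x‖ ^ 2 := by
        refine (Finset.sum_subset Finset.subset_union_right fun x _ hx => ?_).symm
        rw [h0 x (by simpa using hx)]
        simp
    _ ≤ ∑ x ∈ hS.toFinset, C ^ 2 := Finset.sum_le_sum fun x _ => by
        have := hC x
        gcongr
    _ = _ := by rw [Finset.sum_const, nsmul_eq_mul]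

end FiniteSupport

variable {q r : ℕ}

theorem finite_iterate_pred_eq_and_ncard_le [NeZero q] [NeZero r] (c₁ : Tree q) (c₂ : Tree r)
    (a b : ℕ) :
    {y : Vertex q r | Tree.pred^[a] y.fst = c₁ ∧ Tree.pred^[b] y.snd = c₂}.Finite ∧
    {y : Vertex q r | Tree.pred^[a] y.fst = c₁ ∧ Tree.pred^[b] y.snd = c₂}.ncard
      ≤ q ^ a * r ^ b := by
  obtain ⟨h1, h1'⟩ := Tree.finite_iterate_pred_eq_and_ncard_le c₁ a
  obtain ⟨h2, h2'⟩ := Tree.finite_iterate_pred_eq_and_ncard_le c₂ b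
  have hinj : Function.Injective fun y : Vertex q r => (y.fst, y.snd) := fun x y h =>
    Vertex.ext' (congrArg Prod.fst h) (congrArg Prod.snd h)
  have hsub : (fun y : Vertex q r => (y.fst, y.snd)) ''
      {y : Vertex q r | Tree.pred^[a] y.fst = c₁ ∧ Tree.pred^[b] y.snd = c₂} ⊆
      {y | Tree.pred^[a] y = c₁} ×ˢ {y | Tree.pred^[b] y = c₂} := by
    rintro _ ⟨y, ⟨hy1, hy2⟩, rfl⟩
    exact ⟨hy1, hy2⟩
  refine ⟨Set.Finite.of_finite_image ((h1.prod h2).subset hsub) hinj.injOn, ?_⟩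
  rw [← Set.ncard_image_of_injective _ hinj]
  refine (Set.ncard_le_ncard hsub (h1.prod h2)).trans ?_
  rw [Set.ncard_prod]
  exact Nat.mul_le_mul h1' h2'

/-! ### Eigenvectors supported on tetrahedra -/

section Tetrahedron

variable [NeZero q] [NeZero r]

theorem norm_branch_mul_branch_le (c₁ : Tree q) (c₂ : Tree r) (a b : ℕ) (y : Vertex q r) :
    ‖((Tree.branch c₁ a y.fst * Tree.branch c₂ b y.snd : ℝ) : ℂ)‖ ≤ 1 := by
  rw [Complex.norm_real, norm_mul]
  exact mul_le_one₀ (Tree.abs_branch_le _ _ _) (norm_nonneg _) (Tree.abs_branch_le _ _ _)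

omit [NeZero q] [NeZero r] in
theorem branch_mul_branch_eq_zero (c₁ : Tree q) (c₂ : Tree r) (a b : ℕ) (y : Vertex q r)
    (hy : y ∉ {y : Vertex q r | Tree.pred^[a + 1] y.fst = c₁.pred ∧
      Tree.pred^[b + 1] y.snd = c₂.pred}) :
    ((Tree.branch c₁ a y.fst * Tree.branch c₂ b y.snd : ℝ) : ℂ) = 0 := by
  rw [Set.mem_ofPred_eq, not_and_or] at hy
  rcases hy with hy | hy
  · rw [Tree.branch_eq_zero _ _ _ hy]; simp
  · rw [Tree.branch_eq_zero _ _ _ hy]; simp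

/-- The product of two branch functions, as an element of `ℓ²(DL(q,r))`. -/
noncomputable def tetra (c₁ : Tree q) (c₂ : Tree r) (a b : ℕ) :
    lp (fun _ : Vertex q r => ℂ) 2 :=
  ⟨fun y => ((Tree.branch c₁ a y.fst * Tree.branch c₂ b y.snd : ℝ) : ℂ),
    memℓp_gen' (sum_norm_sq_le (finite_iterate_pred_eq_and_ncard_le _ _ _ _).1
      (branch_mul_branch_eq_zero c₁ c₂ a b) (norm_branch_mul_branch_le c₁ c₂ a b))⟩

theorem tetra_apply (c₁ : Tree q) (c₂ : Tree r) (a b : ℕ) (y : Vertex q r) :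
    tetra c₁ c₂ a b y = ((Tree.branch c₁ a y.fst * Tree.branch c₂ b y.snd : ℝ) : ℂ) := rfl

/-- Values are at most 1 in modulus, so the norm is at most the square root of the size of the
support. -/
theorem norm_tetra_le (c₁ : Tree q) (c₂ : Tree r) (a b : ℕ) :
    ‖tetra c₁ c₂ a b‖ ≤ √((q : ℝ) ^ (a + 1) * (r : ℝ) ^ (b + 1)) := by
  obtain ⟨h1, h2⟩ := finite_iterate_pred_eq_and_ncard_le c₁.pred c₂.pred (a + 1) (b + 1)
  refine (lp.norm_le_of_forall_sum_le (by norm_num) (by positivity) (sum_norm_sq_le h1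
    (branch_mul_branch_eq_zero c₁ c₂ a b) (norm_branch_mul_branch_le c₁ c₂ a b))).trans ?_
  rw [mul_one]
  exact Real.sqrt_le_sqrt (by exact_mod_cast h2)

theorem transitionOperator_apply (f : lp (fun _ : Vertex q r => ℂ) 2) (y : Vertex q r) :
    transitionOperator q r f y = ((q : ℂ) + r)⁻¹ *
      (∑ s, f (step y (Sum.inl s)) + ∑ t, f (step y (Sum.inr t))) := by
  classical
  have himg : (graph q r).neighborFinset y = Finset.univ.image (step y) := by
    ext z
    rw [SimpleGraph.mem_neighborFinset, ← SimpleGraph.mem_neighborSet, ← range_step]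
    simp
  rw [transitionOperator, srw_apply, himg, Finset.sum_image (step_injective y).injOn,
    Fintype.sum_sum_type, isRegular.degree_eq, mul_add, Finset.mul_sum, Finset.mul_sum]
  push_cast
  simp only [one_div]

/-- The superposition of the `tetra c₁ c₂ a b`, `a + b = N`, with a sinusoidal profile. -/
noncomputable def wave (c₁ : Tree q) (c₂ : Tree r) (N : ℕ) (θ : ℝ) :
    lp (fun _ : Vertex q r => ℂ) 2 :=
  ∑ p ∈ antidiagonal N,
    ((√((r : ℝ) / q) ^ p.1 * Real.sin ((p.1 + 1 : ℕ) * θ) : ℝ) : ℂ) • tetra c₁ c₂ p.1 p.2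

theorem wave_apply (c₁ : Tree q) (c₂ : Tree r) (N : ℕ) (θ : ℝ) (y : Vertex q r) :
    wave c₁ c₂ N θ y = ((∑ p ∈ antidiagonal N,
      √((r : ℝ) / q) ^ p.1 * Real.sin ((p.1 + 1 : ℕ) * θ) *
        (Tree.branch c₁ p.1 y.fst * Tree.branch c₂ p.2 y.snd) : ℝ) : ℂ) := by
  rw [wave, lp.coeFn_sum, Finset.sum_apply, Complex.ofReal_sum]
  refine Finset.sum_congr rfl fun p _ => ?_
  rw [lp.coeFn_smul, Pi.smul_apply, tetra_apply, smul_eq_mul]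
  push_cast
  ring

theorem mul_sqrt_div (q r : ℕ) [NeZero q] :
    (q : ℝ) * √((r : ℝ) / q) = √((q : ℝ) * r) ∧ √((q : ℝ) * r) * √((r : ℝ) / q) = r := by
  have hq : (0 : ℝ) < q := by exact_mod_cast NeZero.pos q
  have h : (q : ℝ) * √((r : ℝ) / q) = √((q : ℝ) * r) := by
    rw [← Real.sqrt_sq hq.le, ← Real.sqrt_mul (by positivity), Real.sqrt_sq hq.le]
    congr 1
    field_simp
  refine ⟨h, ?_⟩
  rw [← h, mul_assoc, Real.mul_self_sqrt (by positivity)]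
  field_simp

theorem sum_branch_succ_eq (c : Tree q) (a : ℕ) (y : Tree q) :
    ∑ s, Tree.branch c a (y.succ s) = q * shiftSeq (fun a => Tree.branch c a y) a := by
  cases a with
  | zero => rw [Tree.sum_branch_zero_succ, shiftSeq, mul_zero]
  | succ a => rw [Tree.sum_branch_succ, shiftSeq]

/-- Neighbours through `Sum.inl` lower the first index by one and raise the second, with factor `q`;
those through `Sum.inr` do the reverse, with factor `r`. What remains is `sum_antidiagonal_sin` with
`w = √(r/q)` and `κ = √(qr)`. -/
theorem transitionOperator_wave (c₁ : Tree q) (c₂ : Tree r) {N : ℕ} {θ : ℝ}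
    (hθ : Real.sin ((N + 2 : ℕ) * θ) = 0) :
    transitionOperator q r (wave c₁ c₂ N θ) =
      ((2 * √((q : ℝ) * r) / (q + r) * Real.cos θ : ℝ) : ℂ) • wave c₁ c₂ N θ := by
  obtain ⟨hq, hr⟩ := mul_sqrt_div q r
  ext y
  rw [transitionOperator_apply, lp.coeFn_smul, Pi.smul_apply, smul_eq_mul]
  simp only [wave_apply]
  have h := sum_antidiagonal_sin hq hr hθ (fun a => Tree.branch c₁ a y.fst)
    (fun b => Tree.branch c₂ b y.snd)
  have hinl : ∀ s : ZMod q, (step y (Sum.inl s)).fst = y.fst.succ s ∧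
      (step y (Sum.inl s)).snd = y.snd.pred := fun s => ⟨rfl, rfl⟩
  have hinr : ∀ t : ZMod r, (step y (Sum.inr t)).fst = y.fst.pred ∧
      (step y (Sum.inr t)).snd = y.snd.succ t := fun s => ⟨rfl, rfl⟩
  have hl : ∑ s : ZMod q, ∑ p ∈ antidiagonal N,
      √((r : ℝ) / q) ^ p.1 * Real.sin ((p.1 + 1 : ℕ) * θ) *
        (Tree.branch c₁ p.1 (step y (Sum.inl s)).fst * Tree.branch c₂ p.2 (step y (Sum.inl s)).snd)
      + ∑ t : ZMod r, ∑ p ∈ antidiagonal N,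
      √((r : ℝ) / q) ^ p.1 * Real.sin ((p.1 + 1 : ℕ) * θ) *
        (Tree.branch c₁ p.1 (step y (Sum.inr t)).fst * Tree.branch c₂ p.2 (step y (Sum.inr t)).snd)
      = 2 * √((q : ℝ) * r) * Real.cos θ * ∑ p ∈ antidiagonal N,
      √((r : ℝ) / q) ^ p.1 * Real.sin ((p.1 + 1 : ℕ) * θ) *
        (Tree.branch c₁ p.1 y.fst * Tree.branch c₂ p.2 y.snd) := by
    rw [← h, Finset.sum_comm, Finset.sum_comm (s := (Finset.univ : Finset (ZMod r))),
      ← Finset.sum_add_distrib]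
    refine Finset.sum_congr rfl fun p _ => ?_
    simp only [hinl, hinr, Tree.branch_pred, ← Finset.mul_sum, ← Finset.sum_mul,
      sum_branch_succ_eq]
    ring
  rw [← Complex.ofReal_sum, ← Complex.ofReal_sum, ← Complex.ofReal_add, hl]
  push_cast
  ring

/-- Fourier inversion on the path. -/
theorem tetra_eq_sum_wave (c₁ : Tree q) (c₂ : Tree r) (hr : 0 < r) {N : ℕ} {p : ℕ × ℕ}
    (hp : p ∈ antidiagonal N) :
    tetra c₁ c₂ p.1 p.2 = ∑ m ∈ Finset.range (N + 2),
      ((2 / (N + 2 : ℕ) * (√((r : ℝ) / q) ^ p.1)⁻¹ *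
        Real.sin ((p.1 + 1 : ℕ) * ((m : ℝ) / (N + 2 : ℕ) * Real.pi)) : ℝ) : ℂ) •
      wave c₁ c₂ N ((m : ℝ) / (N + 2 : ℕ) * Real.pi) := by
  have hq' : (0 : ℝ) < q := by exact_mod_cast NeZero.pos q
  have hr' : (0 : ℝ) < r := by exact_mod_cast hr
  have hw : √((r : ℝ) / q) ≠ 0 := (Real.sqrt_pos.2 (by positivity)).ne'
  -- Orthogonality of the sine vectors; the powers of `√(r/q)` cancel on the diagonal. The index `m
  -- = 0` is harmless since its sines vanish.
  have hcoef : ∀ p' ∈ antidiagonal N, ∑ m ∈ Finset.range (N + 2),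
      (2 / (N + 2 : ℕ) * (√((r : ℝ) / q) ^ p.1)⁻¹ *
        Real.sin ((p.1 + 1 : ℕ) * ((m : ℝ) / (N + 2 : ℕ) * Real.pi))) *
      (√((r : ℝ) / q) ^ p'.1 * Real.sin ((p'.1 + 1 : ℕ) * ((m : ℝ) / (N + 2 : ℕ) * Real.pi))) =
      if p.1 + 1 = p'.1 + 1 then 1 else 0 := by
    intro p' hp'
    rw [Finset.HasAntidiagonal.mem_antidiagonal] at hp hp'
    have h := sum_range_sin_mul_sin (n := N + 2) (i := p.1 + 1) (j := p'.1 + 1)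
      (by omega) (by omega) (by omega) (by omega)
    have e : ∀ m : ℕ, (2 / (N + 2 : ℕ) * (√((r : ℝ) / q) ^ p.1)⁻¹ *
        Real.sin ((p.1 + 1 : ℕ) * ((m : ℝ) / (N + 2 : ℕ) * Real.pi))) *
      (√((r : ℝ) / q) ^ p'.1 * Real.sin ((p'.1 + 1 : ℕ) * ((m : ℝ) / (N + 2 : ℕ) * Real.pi))) =
      2 / (N + 2 : ℕ) * (√((r : ℝ) / q) ^ p.1)⁻¹ * √((r : ℝ) / q) ^ p'.1 *
      (Real.sin ((p.1 + 1 : ℕ) * ((m : ℝ) / (N + 2 : ℕ) * Real.pi)) *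
        Real.sin ((p'.1 + 1 : ℕ) * ((m : ℝ) / (N + 2 : ℕ) * Real.pi))) := fun m => by ring
    simp only [e]
    rw [← Finset.mul_sum, h]
    split_ifs with hpp
    · rw [Nat.succ_injective hpp]
      have : ((N + 2 : ℕ) : ℝ) ≠ 0 := by positivity
      field_simp
    · rw [mul_zero]
  simp only [wave, Finset.smul_sum, smul_smul]
  rw [Finset.sum_comm]
  simp only [← Finset.sum_smul, ← Complex.ofReal_mul, ← Complex.ofReal_sum]
  rw [Finset.sum_eq_single p]
  · rw [hcoef p hp, if_pos rfl, Complex.ofReal_one, one_smul]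
  · intro p' hp' hne
    rw [hcoef p' hp', if_neg, Complex.ofReal_zero, zero_smul]
    intro h
    rw [Finset.HasAntidiagonal.mem_antidiagonal] at hp hp'
    exact hne (Prod.ext (by omega) (by omega))
  · exact fun h => absurd hp h

end Tetrahedron

/-! ### Existence of the resolution of the identity -/

theorem inner_pointMass (x : Vertex q r) (f : lp (fun _ : Vertex q r => ℂ) 2) :
    ⟪pointMass x, f⟫_ℂ = f x := by
  classical
  have : pointMass x = lp.single 2 x (1 : ℂ) := by
    unfold pointMass
    congr
  rw [this, lp.inner_single_left]
  simp

theorem pointMass_apply [DecidableEq (Vertex q r)] (x y : Vertex q r) :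
    pointMass x y = if y = x then 1 else 0 := by
  have : pointMass x = lp.single 2 x (1 : ℂ) := by
    unfold pointMass
    congr
    exact Subsingleton.elim _ _
  rw [this, lp.coeFn_single, Pi.single_apply]

theorem dense_span_pointMass :
    Dense (Submodule.span ℂ (Set.range (pointMass (q := q) (r := r))) :
      Set (lp (fun _ : Vertex q r => ℂ) 2)) := by
  classical
  intro f
  have h := lp.hasSum_single (p := 2) (by norm_num) f
  refine mem_closure_of_tendsto h (Filter.Eventually.of_forall fun s => ?_)
  refine Submodule.sum_mem _ fun x _ => ?_
  have : lp.single 2 x (f x) = f x • pointMass x := by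
    ext y
    rw [lp.coeFn_single, lp.coeFn_smul, Pi.smul_apply, pointMass_apply, Pi.single_apply]
    simp only [smul_eq_mul, mul_ite, mul_one, mul_zero]
  rw [this]
  exact Submodule.smul_mem _ _ (Submodule.subset_span ⟨x, rfl⟩)

variable [NeZero q] [NeZero r]

theorem isSymmetric_transitionOperator :
    (transitionOperator q r : lp (fun _ : Vertex q r => ℂ) 2 →ₗ[ℂ] _).IsSymmetric := by
  classical
  have hmat : ∀ x y : Vertex q r, transitionOperator q r (pointMass x) y =
      if (graph q r).Adj x y then ((q : ℂ) + r)⁻¹ else 0 := by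
    intro x y
    rw [transitionOperator, srw_apply]
    simp only [pointMass_apply, mul_ite, mul_one, mul_zero, Finset.sum_ite_eq',
      SimpleGraph.mem_neighborFinset, isRegular.degree_eq, SimpleGraph.adj_comm _ y x]
    push_cast
    simp only [one_div]
  rw [← ContinuousLinearMap.isSelfAdjoint_iff_isSymmetric, ContinuousLinearMap.isSelfAdjoint_iff']
  refine ContinuousLinearMap.ext_on dense_span_pointMass ?_
  rintro _ ⟨x, rfl⟩
  ext y
  rw [← inner_pointMass, ContinuousLinearMap.adjoint_inner_right, ← inner_conj_symm,
    inner_pointMass, hmat, hmat, SimpleGraph.adj_comm]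
  split_ifs <;> simp

/-- The product of the two telescoping expansions. It converges absolutely in `ℓ²`, since the
weights `q^{-k₁} r^{-k₂}` against norms of order `q^{k₁/2} r^{k₂/2}` leave a product of geometric
series; the limit is then identified coordinatewise. -/
theorem hasSum_tetra (hq : 2 ≤ q) (hr : 2 ≤ r) (x : Vertex q r) :
    HasSum (fun k : ℕ × ℕ => ((((q : ℝ) ^ k.1)⁻¹ * ((r : ℝ) ^ k.2)⁻¹ : ℝ) : ℂ) •
      tetra (Tree.pred^[k.1] x.fst) (Tree.pred^[k.2] x.snd) k.1 k.2) (pointMass x) := by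
  classical
  have hq0 : (0 : ℝ) < q := by positivity
  have hr0 : (0 : ℝ) < r := by positivity
  have hgeom : ∀ s : ℕ, 2 ≤ s → Summable fun k : ℕ => ((√(s : ℝ))⁻¹) ^ k := fun s hs =>
    summable_geometric_of_lt_one (by positivity) (inv_lt_one_of_one_lt₀ (by
      rw [Real.lt_sqrt zero_le_one]
      norm_num
      omega))
  have hsum : Summable fun k : ℕ × ℕ => ((((q : ℝ) ^ k.1)⁻¹ * ((r : ℝ) ^ k.2)⁻¹ : ℝ) : ℂ) •
      tetra (Tree.pred^[k.1] x.fst) (Tree.pred^[k.2] x.snd) k.1 k.2 := by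
    refine Summable.of_norm_bounded (((hgeom q hq).mul_of_nonneg (hgeom r hr)
      (fun _ => by positivity) (fun _ => by positivity)).mul_left (√q * √r)) fun k => ?_
    rw [norm_smul, Complex.norm_real, Real.norm_of_nonneg (by positivity)]
    refine (mul_le_mul_of_nonneg_left (norm_tetra_le _ _ _ _) (by positivity)).trans_eq ?_
    have hs : ∀ (s : ℝ) (n : ℕ), 0 < s → √(s ^ n) = √s ^ n := fun s n hs =>
      Real.sqrt_eq_iff_mul_self_eq (by positivity) (by positivity) |>.2 (by
        rw [← mul_pow, Real.mul_self_sqrt hs.le])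
    have hsq : ∀ (s : ℝ) (n : ℕ), 0 < s → (s ^ n)⁻¹ * √s ^ (n + 1) = √s * (√s)⁻¹ ^ n := by
      intro s n hs
      have h0 : √s ≠ 0 := (Real.sqrt_pos.2 hs).ne'
      nth_rewrite 1 [← Real.mul_self_sqrt hs.le]
      rw [mul_pow, inv_pow]
      field_simp
      rw [pow_succ]
    rw [Real.sqrt_mul (by positivity), hs _ _ hq0, hs _ _ hr0]
    calc _ = (((q : ℝ) ^ k.1)⁻¹ * √q ^ (k.1 + 1)) * (((r : ℝ) ^ k.2)⁻¹ * √r ^ (k.2 + 1)) := by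
          ring
      _ = _ := by rw [hsq _ _ hq0, hsq _ _ hr0]; ring
  obtain ⟨v, hv⟩ := hsum
  convert hv using 1
  ext y
  have h := hv.mapL (innerSL ℂ (pointMass y))
  simp only [innerSL_apply_apply, inner_pointMass, lp.coeFn_smul, Pi.smul_apply, smul_eq_mul,
    tetra_apply, ← Complex.ofReal_mul] at h
  obtain ⟨h1, h1'⟩ := Tree.hasSum_branch hq x.fst y.fst
  obtain ⟨h2, h2'⟩ := Tree.hasSum_branch hr x.snd y.snd
  have h3 := h1.mul h2 (summable_mul_of_summable_norm h1' h2')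
  have h4 := Complex.hasSum_ofReal.2 h3
  have hxy : (pointMass x y : ℂ) = (((if y.fst = x.fst then (1 : ℝ) else 0) *
      if y.snd = x.snd then (1 : ℝ) else 0 : ℝ) : ℂ) := by
    rw [pointMass_apply]
    by_cases hxy : y = x
    · simp [hxy]
    · rw [if_neg hxy]
      by_cases hy : y.fst = x.fst
      · have : y.snd ≠ x.snd := fun h' => hxy (Vertex.ext' hy h')
        simp [this]
      · simp [hy]
  rw [hxy]
  refine HasSum.unique h4 ?_
  simp only [mul_mul_mul_comm] at h ⊢
  exact h

theorem transitionOperator_wave_eigenvalue (c₁ : Tree q) (c₂ : Tree r) (N m : ℕ) :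
    transitionOperator q r (wave c₁ c₂ N ((m : ℝ) / (N + 2 : ℕ) * Real.pi)) =
      (eigenvalue q r m (N + 2) : ℂ) • wave c₁ c₂ N ((m : ℝ) / (N + 2 : ℕ) * Real.pi) := by
  refine transitionOperator_wave c₁ c₂ ?_
  have : ((N + 2 : ℕ) : ℝ) ≠ 0 := by positivity
  rw [← mul_assoc, mul_div_cancel₀ _ this]
  exact Real.sin_nat_mul_pi m

theorem dense_span_eigenvectors (hq : 2 ≤ q) (hr : 2 ≤ r) :
    Dense (Submodule.span ℂ (eigenvectors (transitionOperator q r)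
      (Set.range fun p : ℕ × ℕ => eigenvalue q r p.1 p.2)) :
        Set (lp (fun _ : Vertex q r => ℂ) 2)) := by
  set K := Submodule.span ℂ (eigenvectors (transitionOperator q r)
      (Set.range fun p : ℕ × ℕ => eigenvalue q r p.1 p.2))
  have hle : Submodule.span ℂ (Set.range (pointMass (q := q) (r := r))) ≤
      K.topologicalClosure := by
    rw [Submodule.span_le]
    rintro _ ⟨x, rfl⟩
    refine mem_closure_of_tendsto (hasSum_tetra hq hr x) (Filter.Eventually.of_forall fun s => ?_)
    refine Submodule.sum_mem _ fun k _ => Submodule.smul_mem _ _ ?_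
    -- The path containing the `k`-th term has `N = k.1 + k.2`.
    rw [tetra_eq_sum_wave _ _ (by omega) (p := k) (N := k.1 + k.2) (by simp)]
    refine Submodule.sum_mem _ fun m _ => Submodule.smul_mem _ _ (Submodule.subset_span ?_)
    exact ⟨_, ⟨(m, _), rfl⟩, transitionOperator_wave_eigenvalue _ _ _ _⟩
  have h := (dense_span_pointMass (q := q) (r := r)).mono hle
  rw [dense_iff_closure_eq, Submodule.topologicalClosure_coe, closure_closure] at h
  exact dense_iff_closure_eq.2 h

theorem exists_isResolutionOfIdentity (hq : 2 ≤ q) (hr : 2 ≤ r) :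
    ∃ E : ProjectionValuedMeasure (lp (fun _ : Vertex q r => ℂ) 2),
      IsResolutionOfIdentity (transitionOperator q r) E :=
  ⟨_, isResolutionOfIdentity_eigenMeasure isSymmetric_transitionOperator (Set.countable_range _)
    (dense_span_eigenvectors hq hr)⟩

/-! ### The spectral measure as a sum over the tetrahedra -/

/-- The contribution of the tetrahedra of height `N + 2` to the mass at `λ_{m,N+2}`. -/
noncomputable def amplitude (x : Vertex q r) (N m : ℕ) : ℝ :=
  ∑ k ∈ antidiagonal N, (((q : ℝ) ^ k.1)⁻¹ * ((r : ℝ) ^ k.2)⁻¹) *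
    ((2 / (N + 2 : ℕ) * (√((r : ℝ) / q) ^ k.1)⁻¹ *
      Real.sin ((k.1 + 1 : ℕ) * ((m : ℝ) / (N + 2 : ℕ) * Real.pi))) *
    ∑ p ∈ antidiagonal N,
      √((r : ℝ) / q) ^ p.1 * Real.sin ((p.1 + 1 : ℕ) * ((m : ℝ) / (N + 2 : ℕ) * Real.pi)) *
        (Tree.branch (Tree.pred^[k.1] x.fst) p.1 (Tree.root q) *
          Tree.branch (Tree.pred^[k.2] x.snd) p.2 (Tree.root r)))

/-- Applies `E(B)` to `hasSum_tetra`, grouped by `N = k₁ + k₂`; after Fourier inversion `E(B)`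
multiplies each wave by an indicator. -/
theorem hasSum_amplitude (hq : 2 ≤ q) (hr : 2 ≤ r) (x : Vertex q r)
    {E : ProjectionValuedMeasure (lp (fun _ : Vertex q r => ℂ) 2)}
    (hE : IsResolutionOfIdentity (transitionOperator q r) E) {B : Set ℝ} (hB : MeasurableSet B) :
    HasSum (fun N : ℕ => ∑ m ∈ Finset.range (N + 2),
        (B.indicator (fun _ => (1 : ℂ)) (eigenvalue q r m (N + 2))) * (amplitude x N m : ℂ))
      (E.matrixElement (pointMass (origin q r)) (pointMass x) B) := by
  have h : HasSum (fun k : ℕ × ℕ => ⟪pointMass (origin q r), E.toFun B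
      (((((q : ℝ) ^ k.1)⁻¹ * ((r : ℝ) ^ k.2)⁻¹ : ℝ) : ℂ) •
        tetra (Tree.pred^[k.1] x.fst) (Tree.pred^[k.2] x.snd) k.1 k.2)⟫_ℂ)
      ⟪pointMass (origin q r), E.toFun B (pointMass x)⟫_ℂ :=
    (hasSum_tetra hq hr x).mapL ((innerSL ℂ (pointMass (origin q r))).comp (E.toFun B))
  have h' := ((Finset.HasAntidiagonal.sigmaAntidiagonalEquivProd (A := ℕ)).hasSum_iff.2 h).sigma
    fun N => hasSum_fintype _
  rw [E.matrixElement_apply _ _ hB]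
  have hN : ∀ N : ℕ, ∑ m ∈ Finset.range (N + 2),
      (B.indicator (fun _ => (1 : ℂ)) (eigenvalue q r m (N + 2))) * (amplitude x N m : ℂ) =
      ∑ k ∈ antidiagonal N, ⟪pointMass (origin q r), E.toFun B
        (((((q : ℝ) ^ k.1)⁻¹ * ((r : ℝ) ^ k.2)⁻¹ : ℝ) : ℂ) •
          tetra (Tree.pred^[k.1] x.fst) (Tree.pred^[k.2] x.snd) k.1 k.2)⟫_ℂ := by
    intro N
    simp only [amplitude, Complex.ofReal_sum, Finset.mul_sum]
    rw [Finset.sum_comm]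
    refine Finset.sum_congr rfl fun k hk => ?_
    rw [map_smul, tetra_eq_sum_wave _ _ (by omega) hk, map_sum, inner_smul_right, inner_sum,
      Finset.mul_sum]
    refine Finset.sum_congr rfl fun m _ => ?_
    rw [map_smul, E.apply_eigenvector hE (transitionOperator_wave_eigenvalue _ _ _ _) hB,
      inner_smul_right, inner_smul_right, inner_pointMass, wave_apply]
    push_cast
    simp only [Finset.mul_sum, origin, Vertex.fst, Vertex.snd]
    refine Finset.sum_congr rfl fun p _ => ?_
    ring
  simp only [hN]
  convert h' using 1
  funext N
  exact (Finset.sum_coe_sort (antidiagonal N) _).symm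

/-! ### The closed form of the amplitudes -/

-- At `o` the levels single out one index of the path, `p.1 + 1 = j`, so the sum has at most one
-- nonzero term.
open DiestelLeader.Tree in
theorem sum_branch_mul_branch_root (x : Vertex q r) {N : ℕ} {k : ℕ × ℕ} (hk : k ∈ antidiagonal N)
    {θ : ℝ} (hθ : Real.sin ((N + 2 : ℕ) * θ) = 0) :
    (√((r : ℝ) / q) ^ k.1)⁻¹ * ∑ p ∈ antidiagonal N,
      √((r : ℝ) / q) ^ p.1 * Real.sin ((p.1 + 1 : ℕ) * θ) *
        (branch (pred^[k.1] x.fst) p.1 (root q) * branch (pred^[k.2] x.snd) p.2 (root r)) =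
    if dn x.fst ≤ k.1 + 1 ∧ dn x.snd ≤ k.2 + 1 then
      √((r : ℝ) / q) ^ ((up x.fst : ℤ) - dn x.fst) *
        Real.sin ((k.1 + 1 - dn x.fst + up x.fst : ℕ) * θ) *
        (branchCoeff q (k.1 + 1 - dn x.fst) / q * (branchCoeff r (k.2 + 1 - dn x.snd) / r))
    else 0 := by
  have hq' : (0 : ℝ) < q := by exact_mod_cast NeZero.pos q
  have hr' : (0 : ℝ) < r := by exact_mod_cast NeZero.pos r
  have hw : √((r : ℝ) / q) ≠ 0 := (Real.sqrt_pos.2 (by positivity)).ne'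
  have hlev := x.level_add
  rw [level_eq, level_eq] at hlev
  rw [Finset.HasAntidiagonal.mem_antidiagonal] at hk
  simp only [branch_iterate_pred_root]
  split_ifs with h
  · set j := k.1 + 1 - dn x.fst + up x.fst with hj
    have hzero : ∀ p ∈ antidiagonal N, p.1 + 1 ≠ j →
        √((r : ℝ) / q) ^ p.1 * Real.sin ((p.1 + 1 : ℕ) * θ) *
        ((if dn x.fst ≤ k.1 + 1 ∧ p.1 + 1 + dn x.fst = k.1 + 1 + up x.fst then
          branchCoeff q (k.1 + 1 - dn x.fst) / q else 0) *
        (if dn x.snd ≤ k.2 + 1 ∧ p.2 + 1 + dn x.snd = k.2 + 1 + up x.snd then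
          branchCoeff r (k.2 + 1 - dn x.snd) / r else 0)) = 0 := by
      intro p _ hp
      rw [if_neg (fun hh => hp (by omega)), zero_mul, mul_zero]
    -- These `j` lie just off the path, where no index `p` exists, but `sin (jθ)` vanishes there
    -- too, so the same formula holds.
    by_cases hj0 : j = 0 ∨ j = N + 2
    · rw [Finset.sum_eq_zero fun p hp => hzero p hp (by
        rw [Finset.HasAntidiagonal.mem_antidiagonal] at hp
        omega)]
      have : Real.sin ((j : ℕ) * θ) = 0 := by
        rcases hj0 with hj0 | hj0
        · simp [hj0]
        · rw [hj0, hθ]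
      rw [this]
      simp
    · rw [Finset.sum_eq_single (j - 1, N + 1 - j)]
      · dsimp only
        rw [if_pos (by omega), if_pos (by omega), Nat.sub_add_cancel (by omega)]
        have hpow : (√((r : ℝ) / q) ^ k.1)⁻¹ * √((r : ℝ) / q) ^ (j - 1) =
            √((r : ℝ) / q) ^ ((up x.fst : ℤ) - dn x.fst) := by
          rw [← zpow_natCast, ← zpow_natCast, ← zpow_neg, ← zpow_add₀ hw]
          congr 1
          omega
        rw [← hpow]
        ring
      · intro p hp hne
        refine hzero p hp fun h' => hne ?_
        rw [Finset.HasAntidiagonal.mem_antidiagonal] at hp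
        exact Prod.ext (by omega) (by simp only; omega)
      · intro h'
        rw [Finset.HasAntidiagonal.mem_antidiagonal] at h'
        omega
  · rw [Finset.sum_eq_zero, mul_zero]
    intro p _
    rcases not_and_or.1 h with h | h
    · rw [if_neg (fun hh => h hh.1), zero_mul, mul_zero]
    · rw [if_neg (fun hh => h hh.1 : ¬ (dn x.snd ≤ k.2 + 1 ∧ _)), mul_zero, mul_zero]

theorem sin_natCast_mul_div_mul_pi {n : ℕ} (hn : n ≠ 0) (m : ℕ) :
    Real.sin (n * ((m : ℝ) / n * Real.pi)) = 0 := by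
  rw [← mul_assoc, mul_div_cancel₀ _ (by exact_mod_cast hn)]
  exact Real.sin_nat_mul_pi m

/-- The contribution to the mass at `λ_{m,n}` of the tetrahedron whose top vertex in the first tree
is the `h`-th ancestor of `x₁`. -/
noncomputable def tetraMass (x : Vertex q r) (n m h : ℕ) : ℝ :=
  2 / n * (((q : ℝ) ^ h)⁻¹ * ((r : ℝ) ^ (n - h))⁻¹) *
    (Tree.branchCoeff q (h - x.fst.dn) * Tree.branchCoeff r (n - h - x.snd.dn)) *
    √((r : ℝ) / q) ^ ((x.fst.up : ℤ) - x.fst.dn) *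
    Real.sin (h * ((m : ℝ) / n * Real.pi)) *
    Real.sin ((h - x.fst.dn + x.fst.up : ℕ) * ((m : ℝ) / n * Real.pi))

/-- With `h = k₁ + 1`, the denominators `q` and `r` of the branch values turn `q^{-k₁} r^{-k₂}` into
`q^{-h} r^{-(n-h)}`, where `n = N + 2`. -/
theorem amplitude_eq (x : Vertex q r) (N m : ℕ) :
    amplitude x N m = ∑ k ∈ antidiagonal N,
      if x.fst.dn ≤ k.1 + 1 ∧ x.snd.dn ≤ k.2 + 1 then tetraMass x (N + 2) m (k.1 + 1) else 0 := by
  refine Finset.sum_congr rfl fun k hk => ?_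
  have h := sum_branch_mul_branch_root x hk (sin_natCast_mul_div_mul_pi (n := N + 2) (by omega) m)
  rw [Finset.HasAntidiagonal.mem_antidiagonal] at hk
  have e : ∀ a b w s t : ℝ, a * (b * w * s * t) = a * b * s * (w * t) := fun a b w s t => by ring
  rw [e, h]
  split_ifs with hd
  · rw [tetraMass, show N + 2 - (k.1 + 1) = k.2 + 1 by omega]
    have hq' : (q : ℝ) ≠ 0 := by exact_mod_cast NeZero.ne q
    have hr' : (r : ℝ) ≠ 0 := by exact_mod_cast NeZero.ne r
    rw [pow_succ, pow_succ, mul_inv, mul_inv]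
    ring
  · ring

theorem abs_branchCoeff_div_le (q k : ℕ) (hq : 2 ≤ q) : |Tree.branchCoeff q k| / q ≤ 1 := by
  have : (2 : ℝ) ≤ q := by exact_mod_cast hq
  rw [div_le_one (by linarith), Tree.branchCoeff, abs_le]
  split_ifs <;> constructor <;> linarith

omit [NeZero q] [NeZero r] in
theorem abs_tetraMass_le (hq : 2 ≤ q) (hr : 2 ≤ r) (x : Vertex q r) (m : ℕ) {N : ℕ} {k : ℕ × ℕ}
    (hk : k ∈ antidiagonal N) :
    |tetraMass x (N + 2) m (k.1 + 1)| ≤ 2 / (N + 2 : ℕ) *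
      √((r : ℝ) / q) ^ ((x.fst.up : ℤ) - x.fst.dn) * ((q : ℝ)⁻¹ ^ k.1 * (r : ℝ)⁻¹ ^ k.2) := by
  rw [Finset.HasAntidiagonal.mem_antidiagonal] at hk
  rw [tetraMass, show N + 2 - (k.1 + 1) = k.2 + 1 by omega]
  simp only [abs_mul]
  rw [abs_of_nonneg (by positivity : (0 : ℝ) ≤ 2 / (N + 2 : ℕ)),
    abs_of_nonneg (by positivity : (0 : ℝ) ≤ ((q : ℝ) ^ (k.1 + 1))⁻¹),
    abs_of_nonneg (by positivity : (0 : ℝ) ≤ ((r : ℝ) ^ (k.2 + 1))⁻¹),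
    abs_of_nonneg (by positivity : (0 : ℝ) ≤ √((r : ℝ) / q) ^ ((x.fst.up : ℤ) - x.fst.dn))]
  have h1 := abs_branchCoeff_div_le q (k.1 + 1 - x.fst.dn) hq
  have h2 := abs_branchCoeff_div_le r (k.2 + 1 - x.snd.dn) hr
  have h3 := Real.abs_sin_le_one ((k.1 + 1 : ℕ) * ((m : ℝ) / (N + 2 : ℕ) * Real.pi))
  have h4 := Real.abs_sin_le_one
    ((k.1 + 1 - x.fst.dn + x.fst.up : ℕ) * ((m : ℝ) / (N + 2 : ℕ) * Real.pi))
  set D := √((r : ℝ) / q) ^ ((x.fst.up : ℤ) - x.fst.dn)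
  have hD : 0 ≤ D := by positivity
  set s₁ := |Real.sin ((k.1 + 1 : ℕ) * ((m : ℝ) / (N + 2 : ℕ) * Real.pi))|
  set s₂ := |Real.sin ((k.1 + 1 - x.fst.dn + x.fst.up : ℕ) * ((m : ℝ) / (N + 2 : ℕ) * Real.pi))|
  set b₁ := |Tree.branchCoeff q (k.1 + 1 - x.fst.dn)|
  set b₂ := |Tree.branchCoeff r (k.2 + 1 - x.snd.dn)|
  have hb : b₁ / q * (b₂ / r) * (s₁ * s₂) ≤ 1 :=
    mul_le_one₀ (mul_le_one₀ h1 (by positivity) h2) (by positivity) (mul_le_one₀ h3 (by positivity) h4)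
  calc _ = (2 / (N + 2 : ℕ) * D * ((q : ℝ)⁻¹ ^ k.1 * (r : ℝ)⁻¹ ^ k.2)) *
        (b₁ / q * (b₂ / r) * (s₁ * s₂)) := by
        rw [pow_succ, pow_succ, mul_inv, mul_inv, inv_pow, inv_pow]
        ring
    _ ≤ _ := mul_le_of_le_one_right (by positivity) hb

theorem abs_amplitude_le (hq : 2 ≤ q) (hr : 2 ≤ r) (x : Vertex q r) (N m : ℕ) :
    |amplitude x N m| ≤ 2 / (N + 2 : ℕ) * √((r : ℝ) / q) ^ ((x.fst.up : ℤ) - x.fst.dn) *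
      ∑ k ∈ antidiagonal N, ((q : ℝ)⁻¹ ^ k.1 * (r : ℝ)⁻¹ ^ k.2) := by
  rw [amplitude_eq, Finset.mul_sum]
  refine (Finset.abs_sum_le_sum_abs _ _).trans (Finset.sum_le_sum fun k hk => ?_)
  split_ifs
  · exact abs_tetraMass_le hq hr x m hk
  · rw [abs_zero]
    positivity

/-- The `N + 2` values of `m` cancel the factor `2/(N + 2)` up to a constant, leaving the Cauchy
product of two geometric series. -/
theorem summable_amplitude (hq : 2 ≤ q) (hr : 2 ≤ r) (x : Vertex q r) :
    Summable fun p : ℕ × ℕ => ‖if p.2 < p.1 + 2 then amplitude x p.1 p.2 else 0‖ := by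
  have hfin : ∀ N : ℕ, HasSum (fun m => ‖if m < N + 2 then amplitude x N m else 0‖)
      (∑ m ∈ Finset.range (N + 2), |amplitude x N m|) := by
    intro N
    have := hasSum_sum_of_ne_finset_zero (L := SummationFilter.unconditional ℕ)
      (f := fun m => ‖if m < N + 2 then amplitude x N m else 0‖) (s := Finset.range (N + 2))
      (fun m hm => by rw [if_neg (by simpa using hm), norm_zero])
    convert this using 1
    refine Finset.sum_congr rfl fun m hm => ?_
    rw [if_pos (by simpa using hm), Real.norm_eq_abs]
  rw [summable_prod_of_nonneg fun _ => norm_nonneg _]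
  refine ⟨fun N => (hfin N).summable, ?_⟩
  have hgeom : ∀ s : ℕ, 2 ≤ s → Summable fun k : ℕ => ‖((s : ℝ)⁻¹) ^ k‖ := fun s hs => by
    have hs' : ‖(s : ℝ)⁻¹‖ < 1 := by
      rw [norm_inv, Real.norm_natCast]
      exact inv_lt_one_of_one_lt₀ (by exact_mod_cast hs)
    exact (summable_geometric_of_lt_one (norm_nonneg _) hs').congr fun k => (norm_pow _ _).symm
  have hs := (summable_norm_sum_mul_antidiagonal_of_summable_norm (hgeom q hq)
    (hgeom r hr)).mul_left (2 * √((r : ℝ) / q) ^ ((x.fst.up : ℤ) - x.fst.dn))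
  refine Summable.of_nonneg_of_le (fun _ => tsum_nonneg fun _ => norm_nonneg _) (fun N => ?_) hs
  dsimp only
  rw [(hfin N).tsum_eq]
  refine (Finset.sum_le_sum fun m _ => abs_amplitude_le hq hr x N m).trans ?_
  rw [Finset.sum_const, Finset.card_range, nsmul_eq_mul]
  have hN : ((N + 2 : ℕ) : ℝ) ≠ 0 := by positivity
  rw [mul_assoc (2 / _), ← mul_assoc, mul_div_cancel₀ _ hN, ← mul_assoc]
  exact mul_le_mul_of_nonneg_left (Real.le_norm_self _) (by positivity)

theorem hasSum_amplitude_prod (hq : 2 ≤ q) (hr : 2 ≤ r) (x : Vertex q r)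
    {E : ProjectionValuedMeasure (lp (fun _ : Vertex q r => ℂ) 2)}
    (hE : IsResolutionOfIdentity (transitionOperator q r) E) {B : Set ℝ} (hB : MeasurableSet B) :
    HasSum (fun p : ℕ × ℕ =>
        (B.indicator (fun _ => (1 : ℂ)) (eigenvalue q r p.2 (p.1 + 2))) *
          ((if p.2 < p.1 + 2 then amplitude x p.1 p.2 else 0 : ℝ) : ℂ))
      (E.matrixElement (pointMass (origin q r)) (pointMass x) B) := by
  have hs : Summable (fun p : ℕ × ℕ =>
        (B.indicator (fun _ => (1 : ℂ)) (eigenvalue q r p.2 (p.1 + 2))) *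
          ((if p.2 < p.1 + 2 then amplitude x p.1 p.2 else 0 : ℝ) : ℂ)) := by
    refine Summable.of_norm_bounded (summable_amplitude hq hr x) fun p => ?_
    rw [norm_mul, Complex.norm_real]
    refine mul_le_of_le_one_left (norm_nonneg _) ?_
    refine (norm_indicator_le_norm_self _ _).trans ?_
    simp
  -- Absolute summability gives some sum over pairs; summing over `m` first identifies it with the
  -- known iterated sum.
  obtain ⟨a, ha⟩ := hs
  have h := ha.prod_fiberwise (g := fun N => ∑ m ∈ Finset.range (N + 2),
    (B.indicator (fun _ => (1 : ℂ)) (eigenvalue q r m (N + 2))) * (amplitude x N m : ℂ)) fun N => by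
      have := hasSum_sum_of_ne_finset_zero (L := SummationFilter.unconditional ℕ)
        (s := Finset.range (N + 2))
        (f := fun m => (B.indicator (fun _ => (1 : ℂ)) (eigenvalue q r m (N + 2))) *
          ((if m < N + 2 then amplitude x N m else 0 : ℝ) : ℂ))
        (fun m hm => by rw [if_neg (by simpa using hm), Complex.ofReal_zero, mul_zero])
      convert this using 1
      refine Finset.sum_congr rfl fun m hm => ?_
      rw [if_pos (by simpa using hm)]
  rwa [(hasSum_amplitude hq hr x hE hB).unique h]

omit [NeZero q] [NeZero r] in
theorem tetraMass_zero (x : Vertex q r) (n m : ℕ) : tetraMass x n m 0 = 0 := by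
  simp [tetraMass]

omit [NeZero q] [NeZero r] in
theorem tetraMass_self (x : Vertex q r) {n : ℕ} (hn : n ≠ 0) (m : ℕ) : tetraMass x n m n = 0 := by
  rw [tetraMass, sin_natCast_mul_div_mul_pi hn]
  simp

omit [NeZero q] [NeZero r] in
theorem amplitude_zero (x : Vertex q r) (N : ℕ) : amplitude x N 0 = 0 := by
  simp [amplitude]

omit [NeZero q] [NeZero r] in
theorem up_add_up (x : Vertex q r) : x.fst.up + x.snd.up = x.fst.dn + x.snd.dn := by
  have hlev := x.level_add
  rw [Tree.level_eq, Tree.level_eq] at hlev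
  omega

/-- The antidiagonal only gives `1 ≤ h ≤ N + 1`; the ends `h = 0` and `h = N + 2` may be added since
a sine vanishes there. -/
theorem amplitude_eq_sum_range (x : Vertex q r) (N m : ℕ) :
    amplitude x N m = ∑ h ∈ Finset.range (N + 3),
      if x.fst.dn ≤ h ∧ h + x.snd.dn ≤ N + 2 then tetraMass x (N + 2) m h else 0 := by
  rw [amplitude_eq, Finset.sum_range_succ, Finset.sum_range_succ', tetraMass_zero,
    tetraMass_self x (by omega), ite_self, ite_self, add_zero, add_zero,
    Finset.Nat.sum_antidiagonal_eq_sum_range_succ_mk]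
  refine Finset.sum_congr rfl fun h hh => ?_
  rw [Finset.mem_range] at hh
  exact if_congr (by omega) rfl rfl

theorem amplitude_eq_zero (x : Vertex q r) {N : ℕ} (m : ℕ) (h : N + 2 < nu x) :
    amplitude x N m = 0 := by
  rw [nu, up_add_up] at h
  rw [amplitude_eq_sum_range]
  exact Finset.sum_eq_zero fun h _ => if_neg (by omega)

theorem amplitude_eq_sum_range_of_le (x : Vertex q r) {N : ℕ} (m : ℕ) (h : nu x ≤ N + 2) :
    amplitude x N m =
      ∑ k ∈ Finset.range (N + 2 - nu x + 1), tetraMass x (N + 2) m (x.fst.dn + k) := by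
  rw [nu, up_add_up] at h ⊢
  rw [amplitude_eq_sum_range, show N + 3 = x.fst.dn + (N + 2 - (x.fst.dn + x.snd.dn) + 1)
    + x.snd.dn by omega, Finset.sum_range_add, Finset.sum_range_add,
    Finset.sum_eq_zero fun h hh => if_neg (by rw [Finset.mem_range] at hh; omega), zero_add,
    Finset.sum_eq_zero (s := Finset.range x.snd.dn) fun h hh => if_neg (by omega), add_zero]
  refine Finset.sum_congr rfl fun h hh => ?_
  rw [Finset.mem_range] at hh
  rw [if_pos (by omega)]

theorem coeff_eq (q r k₁ k₂ : ℕ) : coeff q r k₁ k₂ = Tree.branchCoeff q k₁ * Tree.branchCoeff r k₂ := by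
  unfold coeff Tree.branchCoeff
  split_ifs <;> ring

/-- The exponent of `r/q`, after extracting `r^{-n}`, is `(d + h) + (u - d)/2 = h + (u + d)/2`, and
`u + d` is the distance to the root. -/
theorem weight_eq (q r d u h n : ℕ) [NeZero q] [NeZero r] (hd : d + h ≤ n) :
    ((q : ℝ) ^ (d + h))⁻¹ * ((r : ℝ) ^ (n - (d + h)))⁻¹ * √((r : ℝ) / q) ^ ((u : ℤ) - d) =
      ((r : ℝ) ^ n)⁻¹ * ((r : ℝ) / q) ^ ((h : ℝ) + ((u + d : ℕ) : ℝ) / 2) := by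
  have hq' : (0 : ℝ) < q := by exact_mod_cast NeZero.pos q
  have hr' : (0 : ℝ) < r := by exact_mod_cast NeZero.pos r
  have hrq : (0 : ℝ) < (r : ℝ) / q := by positivity
  have hw : √((r : ℝ) / q) ≠ 0 := (Real.sqrt_pos.2 hrq).ne'
  have e1 : ((r : ℝ) / q) ^ ((h : ℝ) + ((u + d : ℕ) : ℝ) / 2) = √((r : ℝ) / q) ^ (2 * h + (u + d)) := by
    rw [Real.sqrt_eq_rpow, ← Real.rpow_natCast, ← Real.rpow_mul hrq.le]
    congr 1
    push_cast
    ring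
  have e2 : √((r : ℝ) / q) ^ (2 * h + (u + d)) =
      (√((r : ℝ) / q) ^ 2) ^ (d + h) * √((r : ℝ) / q) ^ ((u : ℤ) - d) := by
    rw [← pow_mul, ← zpow_natCast, ← zpow_natCast, ← zpow_add₀ hw]
    congr 1
    push_cast
    ring
  rw [e1, e2, Real.sq_sqrt hrq.le, div_pow, ← mul_assoc]
  congr 1
  rw [show (r : ℝ) ^ n = (r : ℝ) ^ (d + h) * (r : ℝ) ^ (n - (d + h)) by
    rw [← pow_add, Nat.add_sub_cancel' hd]]
  field_simp

theorem amplitude_eq_term (x : Vertex q r) {m n l N : ℕ} (hl : 1 ≤ l) (hN : N + 2 = l * n)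
    (h : nu x ≤ l * n) : amplitude x N (l * m) = term x m n l := by
  have hl0 : (l : ℝ) ≠ 0 := by exact_mod_cast (by omega : l ≠ 0)
  rw [amplitude_eq_sum_range_of_le x _ (hN ▸ h), hN, term, Finset.mul_sum]
  refine Finset.sum_congr rfl fun k hk => ?_
  rw [Finset.mem_range] at hk
  have hu := up_add_up x
  have hnu : nu x = x.fst.up + x.snd.up := rfl
  have hθ : ((l * m : ℕ) : ℝ) / (l * n : ℕ) * Real.pi = (m : ℝ) / n * Real.pi := by
    push_cast
    rw [mul_div_mul_left _ _ hl0]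
  have hw := weight_eq q r x.fst.dn x.fst.up k (l * n) (by omega)
  rw [tetraMass, hθ, coeff_eq, Tree.dist_root, Nat.add_sub_cancel_left,
    show l * n - (x.fst.dn + k) - x.snd.dn = l * n - nu x - k by omega]
  push_cast at hw ⊢
  have e : ∀ a w₁ c w₂ s t : ℝ, a * w₁ * c * w₂ * s * t = a * (w₁ * w₂) * c * s * t :=
    fun _ _ _ _ _ _ => by ring
  rw [e, hw, ← mul_assoc _ (_ / _ : ℝ) Real.pi, ← mul_assoc _ (_ / _ : ℝ) Real.pi,
    add_comm (x.fst.dn : ℝ) (k : ℝ)]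
  ring

/-! ### Regrouping the eigenvalues -/

theorem eigenvalue_mul (q r m n : ℕ) {l : ℕ} (hl : 1 ≤ l) :
    eigenvalue q r (l * m) (l * n) = eigenvalue q r m n := by
  have hl0 : (l : ℝ) ≠ 0 := by exact_mod_cast (by omega : l ≠ 0)
  rw [eigenvalue, eigenvalue]
  push_cast
  rw [mul_div_mul_left _ _ hl0]

/-- The cosine is injective on `[0, π]`, and a fraction in lowest terms determines its numerator and
denominator. -/
theorem eigenvalue_injective (q r : ℕ) [NeZero q] [NeZero r] {p p' : ℕ × ℕ}
    (hp : 1 ≤ p.1 ∧ p.1 < p.2 ∧ Nat.Coprime p.1 p.2)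
    (hp' : 1 ≤ p'.1 ∧ p'.1 < p'.2 ∧ Nat.Coprime p'.1 p'.2)
    (h : eigenvalue q r p.1 p.2 = eigenvalue q r p'.1 p'.2) : p = p' := by
  have hq' : (0 : ℝ) < q := by exact_mod_cast NeZero.pos q
  have hr' : (0 : ℝ) < r := by exact_mod_cast NeZero.pos r
  have hc : 2 * √((q : ℝ) * r) / ((q : ℝ) + r) ≠ 0 := by positivity
  have hcos := mul_left_cancel₀ hc h
  have hmem : ∀ p : ℕ × ℕ, p.1 < p.2 → (p.1 : ℝ) / p.2 * Real.pi ∈ Set.Icc 0 Real.pi := by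
    intro p hp
    have hp' : (p.1 : ℝ) < p.2 := by exact_mod_cast hp
    have h0 : (0 : ℝ) ≤ p.1 := by positivity
    refine ⟨by positivity, mul_le_of_le_one_left Real.pi_pos.le ?_⟩
    rw [div_le_one (by linarith)]
    exact hp'.le
  have h1 := mul_right_cancel₀ Real.pi_pos.ne'
    (Real.injOn_cos (hmem p hp.2.1) (hmem p' hp'.2.1) hcos)
  have e1 : (p.2 : ℝ) ≠ 0 := by exact_mod_cast (by omega : p.2 ≠ 0)
  have e2 : (p'.2 : ℝ) ≠ 0 := by exact_mod_cast (by omega : p'.2 ≠ 0)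
  rw [div_eq_div_iff e1 e2] at h1
  have h2 : p.1 * p'.2 = p'.1 * p.2 := by exact_mod_cast h1
  have d1 : p.2 ∣ p'.2 := hp.2.2.symm.dvd_of_dvd_mul_left (h2 ▸ Dvd.intro_left _ rfl)
  have d2 : p'.2 ∣ p.2 := hp'.2.2.symm.dvd_of_dvd_mul_left (h2 ▸ Dvd.intro_left _ rfl)
  have e := Nat.dvd_antisymm d1 d2
  rw [← e] at h2
  exact Prod.ext (Nat.eq_of_mul_eq_mul_right (by omega) h2) e

/-- The multiples of the reduced fractions in `(0,1)`. -/
theorem injective_mul_reduced : Function.Injective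
    fun z : {p : ℕ × ℕ // 1 ≤ p.1 ∧ p.1 < p.2 ∧ Nat.Coprime p.1 p.2} × {l : ℕ // 1 ≤ l} =>
      ((z.2.1 * z.1.1.2 - 2, z.2.1 * z.1.1.1) : ℕ × ℕ) := by
  rintro ⟨⟨⟨m, n⟩, h1, h2, h3⟩, l, hl⟩ ⟨⟨⟨m', n'⟩, h1', h2', h3'⟩, l', hl'⟩ h
  dsimp only at h1 h2 h3 h1' h2' h3' h
  obtain ⟨e1, e2⟩ := Prod.mk.inj h
  -- Ensures that the truncated subtraction `l * n - 2` loses nothing.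
  have i1 : 1 * 2 ≤ l * n := Nat.mul_le_mul hl (by omega)
  have i2 : 1 * 2 ≤ l' * n' := Nat.mul_le_mul hl' (by omega)
  have e3 : l * n = l' * n' := by omega
  have el : l = l' := by
    -- Coprimality makes `l` the gcd of `l * m` and `l * n`.
    have := congrArg₂ Nat.gcd e2 e3
    rwa [Nat.gcd_mul_left, Nat.gcd_mul_left, h3.gcd_eq_one, h3'.gcd_eq_one, mul_one, mul_one] at this
  subst el
  have em := Nat.eq_of_mul_eq_mul_left hl e2
  have en := Nat.eq_of_mul_eq_mul_left hl e3
  subst em en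
  rfl

theorem exists_mul_reduced {N m : ℕ} (hm : 1 ≤ m) (hN : m < N + 2) :
    (N, m) ∈ Set.range
      fun z : {p : ℕ × ℕ // 1 ≤ p.1 ∧ p.1 < p.2 ∧ Nat.Coprime p.1 p.2} × {l : ℕ // 1 ≤ l} =>
        ((z.2.1 * z.1.1.2 - 2, z.2.1 * z.1.1.1) : ℕ × ℕ) := by
  obtain ⟨g, m', n', hg, hc, e1, e2⟩ := Nat.exists_coprime' (Nat.gcd_pos_of_pos_left (N + 2) hm)
  have hm' : 1 ≤ m' := Nat.one_le_iff_ne_zero.2 fun h => by subst h; omega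
  have hlt : m' < n' := Nat.lt_of_mul_lt_mul_right (a := g) (by omega)
  refine ⟨⟨⟨(m', n'), hm', hlt, hc⟩, ⟨g, hg⟩⟩, ?_⟩
  dsimp only
  rw [mul_comm g m', mul_comm g n', ← e1, ← e2]
  rfl

theorem hasSum_reduced (hq : 2 ≤ q) (hr : 2 ≤ r) (x : Vertex q r)
    {E : ProjectionValuedMeasure (lp (fun _ : Vertex q r => ℂ) 2)}
    (hE : IsResolutionOfIdentity (transitionOperator q r) E) {B : Set ℝ} (hB : MeasurableSet B) :
    HasSum (fun z : {p : ℕ × ℕ // 1 ≤ p.1 ∧ p.1 < p.2 ∧ Nat.Coprime p.1 p.2} × {l : ℕ // 1 ≤ l} =>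
        (B.indicator (fun _ => (1 : ℂ)) (eigenvalue q r z.1.1.1 z.1.1.2)) *
          (amplitude x (z.2.1 * z.1.1.2 - 2) (z.2.1 * z.1.1.1) : ℂ))
      (E.matrixElement (pointMass (origin q r)) (pointMass x) B) := by
  have h := hasSum_amplitude_prod hq hr x hE hB
  rw [← injective_mul_reduced.hasSum_iff] at h
  · convert h using 1
    funext ⟨⟨⟨m, n⟩, h1, h2, h3⟩, l, hl⟩
    dsimp only at h1 h2 h3
    simp only [Function.comp]
    have i1 : 1 * 2 ≤ l * n := Nat.mul_le_mul hl (by omega)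
    have i2 : l * m < l * n := Nat.mul_lt_mul_of_pos_left h2 hl
    rw [Nat.sub_add_cancel (by omega), if_pos i2, eigenvalue_mul q r m n hl]
  -- Pairs that are not multiples of a reduced fraction have `m = 0`, with zero amplitude, or `m ≥ N
  -- + 2`, already cut off.
  · rintro ⟨N, m⟩ hz
    dsimp only
    split_ifs with hlt
    · rcases Nat.eq_zero_or_pos m with rfl | hm
      · rw [amplitude_zero, Complex.ofReal_zero, mul_zero]
      · exact absurd (exists_mul_reduced hm hlt) hz
    · rw [Complex.ofReal_zero, mul_zero]

/-- For `B` a single eigenvalue, `eigenvalue_injective` leaves only the multiples of one reduced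
fraction. -/
theorem hasSum_mass (hq : 2 ≤ q) (hr : 2 ≤ r) (x : Vertex q r)
    {E : ProjectionValuedMeasure (lp (fun _ : Vertex q r => ℂ) 2)}
    (hE : IsResolutionOfIdentity (transitionOperator q r) E)
    (p : {p : ℕ × ℕ // 1 ≤ p.1 ∧ p.1 < p.2 ∧ Nat.Coprime p.1 p.2}) :
    HasSum (fun l : {l : ℕ // 1 ≤ l} => (amplitude x (l.1 * p.1.2 - 2) (l.1 * p.1.1) : ℂ))
      (E.matrixElement (pointMass (origin q r)) (pointMass x) {eigenvalue q r p.1.1 p.1.2}) := by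
  have h := hasSum_reduced hq hr x hE (measurableSet_singleton (eigenvalue q r p.1.1 p.1.2))
  have hinj : Function.Injective fun l : {l : ℕ // 1 ≤ l} => (p, l) := fun l l' h =>
    (Prod.mk.inj h).2
  rw [← hinj.hasSum_iff] at h
  · convert h using 1
    funext l
    simp [Function.comp]
  · rintro ⟨p', l⟩ hz
    rw [indicator_of_notMem, zero_mul]
    intro h'
    refine hz ⟨l, ?_⟩
    have := eigenvalue_injective q r p'.2 p.2 h'
    rw [Subtype.ext this]

end DiestelLeader

theorem proposition4p1 (q r : ℕ) [NeZero q] [NeZero r] (hq : 2 ≤ q) (hr : 2 ≤ r)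
    (x : DiestelLeader.Vertex q r) :
    -- the transition operator has a resolution of the identity
    (∃ E : DiestelLeader.ProjectionValuedMeasure (lp (fun _ : DiestelLeader.Vertex q r => ℂ) 2),
      DiestelLeader.IsResolutionOfIdentity (DiestelLeader.transitionOperator q r) E) ∧
    ∀ E : DiestelLeader.ProjectionValuedMeasure (lp (fun _ : DiestelLeader.Vertex q r => ℂ) 2),
      DiestelLeader.IsResolutionOfIdentity (DiestelLeader.transitionOperator q r) E →
      ∀ μ : MeasureTheory.VectorMeasure ℝ ℂ,
        μ = E.matrixElement (DiestelLeader.pointMass (DiestelLeader.origin q r))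
          (DiestelLeader.pointMass x) →
        -- `μ = μ_{o,x}` is atomic: it is the sum of its point masses at the numbers `λ_{m,n}`
        (∀ B : Set ℝ, MeasurableSet B →
          HasSum (fun p : {p : ℕ × ℕ // 1 ≤ p.1 ∧ p.1 < p.2 ∧ Nat.Coprime p.1 p.2} =>
            B.indicator (fun t => μ {t}) (DiestelLeader.eigenvalue q r p.1.1 p.1.2)) (μ B)) ∧
        -- the mass at `λ_{m,n}`
        ∀ m n : ℕ, 1 ≤ m → m < n → Nat.Coprime m n →
          HasSum (fun l : {l : ℕ // 1 ≤ l ∧ ⌈(DiestelLeader.nu x : ℝ) / n⌉₊ ≤ l} =>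
            ((DiestelLeader.term x m n l : ℝ) : ℂ))
            (μ {DiestelLeader.eigenvalue q r m n}) := by
  refine ⟨DiestelLeader.exists_isResolutionOfIdentity hq hr, ?_⟩
  rintro E hE μ rfl
  refine ⟨fun B hB => ?_, fun m n hm hmn hc => ?_⟩
  -- Summing over `ℓ` first, the fibre over a reduced fraction gives its point mass, or zero if the
  -- eigenvalue is outside `B`.
  · refine (DiestelLeader.hasSum_reduced hq hr x hE hB).prod_fiberwise fun p => ?_
    have h := (DiestelLeader.hasSum_mass hq hr x hE p).mul_left
      (B.indicator (fun _ => (1 : ℂ)) (DiestelLeader.eigenvalue q r p.1.1 p.1.2))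
    by_cases hp : DiestelLeader.eigenvalue q r p.1.1 p.1.2 ∈ B
    · simp only [Set.indicator_of_mem hp, one_mul] at h ⊢
      exact h
    · simp only [Set.indicator_of_notMem hp, zero_mul] at h ⊢
      exact h
  · have h := DiestelLeader.hasSum_mass hq hr x hE ⟨(m, n), hm, hmn, hc⟩
    have hn : (0 : ℝ) < n := by exact_mod_cast (by omega : 0 < n)
    have hceil : ∀ l : ℕ, ⌈(DiestelLeader.nu x : ℝ) / n⌉₊ ≤ l ↔ DiestelLeader.nu x ≤ l * n := by
      intro l
      rw [Nat.ceil_le, div_le_iff₀ hn]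
      exact_mod_cast Iff.rfl
    have h2 : ∀ l : ℕ, 1 ≤ l → l * n - 2 + 2 = l * n := fun l hl => by
      have : 1 * 2 ≤ l * n := Nat.mul_le_mul hl (by omega)
      omega
    let f : {l : ℕ // 1 ≤ l ∧ ⌈(DiestelLeader.nu x : ℝ) / n⌉₊ ≤ l} → {l : ℕ // 1 ≤ l} :=
      fun l => ⟨l.1, l.2.1⟩
    have hf : Function.Injective f := fun l l' h => 
      Subtype.ext (congrArg (fun z : {l : ℕ // 1 ≤ l} => z.1) h)
    rw [← hf.hasSum_iff] at h
    · convert h using 1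
      funext ⟨l, hl, hl'⟩
      simp only [Function.comp, f]
      rw [DiestelLeader.amplitude_eq_term x hl (h2 l hl) ((hceil l).1 hl')]
    -- An `ℓ` below the ceiling has `ℓn < ν`: the tetrahedra of that height contribute nothing.
    · rintro ⟨l, hl⟩ hz
      have hlt : ¬ DiestelLeader.nu x ≤ l * n := fun hle =>
        hz ⟨⟨l, hl, (hceil l).2 hle⟩, rfl⟩
      dsimp only
      rw [DiestelLeader.amplitude_eq_zero x _ (by rw [h2 l hl]; omega), Complex.ofReal_zero]
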